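/- Let $L,D\ge 0$ be integers, let $\Gamma\in\mathbb R^{L\times L}$ be symmetric positive definite, $\Sigma\in\mathbb R^{D\times D}$ diagonal with positive diagonal entries (both known), and let $A\in\mathbb R^{D\times L}$. For $B\in\mathbb R^{D\times L}$ put $$\Sigma^\star_B=(\Gamma^{-1}+B^\top\Sigma^{-1}B)^{-1},\qquad g(B)=B^\star=\Sigma^\star_B\,B^\top\Sigma^{-1}\in\mathbb R^{L\times D},$$ and write $A^\star=g(A)$, $\Sigma^\star=\Sigma^\star_A$, $\Gamma^\star=\Sigma+A\Gamma A^\top$. Let $(X_i,Y_i)_{i\ge1}$ be i.i.d. random vectors in $\mathbb R^D\times\mathbb R^L$ with $X_i\sim\mathcal N_D(0,\Gamma^\star)$ and $Y_i=A^\star X_i+\varepsilon_i$, where $\varepsilon_i\sim\mathcal N_L(0,\Sigma^\star)$ is independent of $X_i$. For $N\ge1$ let $\mathbf X_N=(X_1,\dots,X_N)$, $\mathbf Y_N=(Y_1,\dots,Y_N)$ (observations as columns) and $$\widehat A=\widehat A_N=\mathbf X_N\mathbf Y_N^\top(\mathbf Y_N\mathbf Y_N^\top)^{-1},\qquad \widehat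 A^\star=g(\widehat A).$$ Let $\mathrm{vec}$ denote the stacking of columns, $\otimes$ the Kronecker product, and $T$ the commutation matrix, $T\,\mathrm{vec}(M)=\mathrm{vec}(M^\top)$ for $M\in\mathbb R^{L\times D}$ (so $T^{-1}=T^\top$). For $B\in\mathbb R^{D\times L}$ define $$\begin{aligned}\Theta(B)={}&\bigl(\Sigma^{-1}+(B^\star)^\top B^\top\Sigma^{-1}BB^\star-2\,\Sigma^{-1}BB^\star\bigr)\otimes\Sigma^\star_B\Gamma^{-1}\Sigma^\star_B\\&+(B^\star)^\top\Gamma^{-1}B^\star\otimes B^\star\Sigma(B^\star)^\top-C_B-C_B^\top,\\ C_B={}&\bigl((I_D-(B^\star)^\top B^\top)\otimes\Sigma^\star_B\Gamma^{-1}\bigr)\,T^{-1}\,\bigl(B^\star\otimes(B^\star)^\top\bigr).\end{aligned}$$ Then the following hold. 1. For every $B\in\mathbb R^{D\times L}$, $g$ is differentiable at $B$ and, for every $H\in\mathbb R^{D\times L}$, $Dg(B).H=\Sigma^\star_BH^\top\Sigma^{-1}-\Sigma^\star_BH^\top\Sigma^{-1}BB^\star-B^\star HB^\star$. The sequence $\sqrt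 N(\mathrm{vec}(\widehat A)-\mathrm{vec}(A))$ converges in distribution to $\mathcal N_{DL}(0,\Gamma^{-1}\otimes\Sigma)$, and for every $B\in\mathbb R^{D\times L}$, $\Theta(B)$ is the covariance matrix of $\mathrm{vec}(Dg(B).Z)$, where $Z$ is a random $D\times L$ matrix with $\mathrm{vec}(Z)\sim\mathcal N_{DL}(0,\Gamma^{-1}\otimes\Sigma)$. 2. $\sqrt N\bigl(\mathrm{vec}(\widehat A^\star)-\mathrm{vec}(A^\star)\bigr)\to\mathcal N_{DL}(0,\Theta(A))$ in distribution as $N\to\infty$. 3. $\Theta(\widehat A)$ is a consistent estimator of $\Theta(A)$: $\Theta(\widehat A)\to\Theta(A)$ in probability, entrywise. If moreover $\Theta(A)$ is invertible, then $$N\,\bigl(\mathrm{vec}(\widehat A^\star)-\mathrm{vec}(A^\star)\bigr)^\top\,\Theta(\widehat A)^{-1}\,\bigl(\mathrm{vec}(\widehat A^\star)-\mathrm{vec}(A^\star)\bigr)\to\chi^2_{DL}$$ in distribution as $N\to\infty$. (Inverses of singular matrices, which occur with probability tending to $0$ in the estimator $\widehat A$ and, when $\Theta(A)$ is invertible, in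 $\Theta(\widehat A)^{-1}$, may be replaced by $0$.) -/

import Mathlib

open MeasureTheory ProbabilityTheory Filter
open scoped Matrix Kronecker Topology

noncomputable section

namespace InverseRegression

variable {L D : ℕ}

/-- The residual covariance `Σ⋆ = (Γ⁻¹ + Aᵀ Σ⁻¹ A)⁻¹` of the forward regression. -/
def sigmaStar (Γ : Matrix (Fin L) (Fin L) ℝ) (S : Matrix (Fin D) (Fin D) ℝ)
    (A : Matrix (Fin D) (Fin L) ℝ) : Matrix (Fin L) (Fin L) ℝ :=
  (Γ⁻¹ + Aᵀ * S⁻¹ * A)⁻¹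

/-- The covariance `Γ⋆ = Σ + A Γ Aᵀ` of the covariates in the forward regression. -/
def gammaStar (Γ : Matrix (Fin L) (Fin L) ℝ) (S : Matrix (Fin D) (Fin D) ℝ)
    (A : Matrix (Fin D) (Fin L) ℝ) : Matrix (Fin D) (Fin D) ℝ :=
  S + A * Γ * Aᵀ

/-- The map `g : A ↦ A⋆ = (Γ⁻¹ + Aᵀ Σ⁻¹ A)⁻¹ Aᵀ Σ⁻¹`. -/
def g (Γ : Matrix (Fin L) (Fin L) ℝ) (S : Matrix (Fin D) (Fin D) ℝ)
    (A : Matrix (Fin D) (Fin L) ℝ) : Matrix (Fin L) (Fin D) ℝ :=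
  (Γ⁻¹ + Aᵀ * S⁻¹ * A)⁻¹ * Aᵀ * S⁻¹

/-- The i.i.d. forward regression model: the pairs `(Xᵢ, Yᵢ)` are independent, `Xᵢ ∼ N(0, Γ⋆)`, and
`Yᵢ = A⋆ Xᵢ + εᵢ` with `εᵢ ∼ N(0, Σ⋆)` independent of `Xᵢ`. -/
structure IsForwardModel {Ω : Type*} [MeasurableSpace Ω] (μ : Measure Ω)
    (X : ℕ → Ω → EuclideanSpace ℝ (Fin D)) (Y : ℕ → Ω → EuclideanSpace ℝ (Fin L))
    (Γs : Matrix (Fin D) (Fin D) ℝ) (As : Matrix (Fin L) (Fin D) ℝ)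
    (Ss : Matrix (Fin L) (Fin L) ℝ) : Prop where
  indep_pairs : iIndepFun (fun i ω => (X i ω, Y i ω)) μ
  law_X : ∀ i, HasLaw (X i) (multivariateGaussian 0 Γs) μ
  law_noise : ∀ i, HasLaw (fun ω => Y i ω - WithLp.toLp 2 (As *ᵥ (X i ω).ofLp))
    (multivariateGaussian 0 Ss) μ
  indep_noise : ∀ i, IndepFun (X i) (fun ω => Y i ω - WithLp.toLp 2 (As *ᵥ (X i ω).ofLp)) μ

/-- The matrix whose columns are the first `N` observations. -/
def dataMatrix {Ω : Type*} {d : ℕ} (X : ℕ → Ω → EuclideanSpace ℝ (Fin d)) (N : ℕ) (ω : Ω) :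
    Matrix (Fin d) (Fin N) ℝ :=
  Matrix.of fun j i => X i ω j

/-- The least squares estimator `Â = X Yᵀ (Y Yᵀ)⁻¹` of the inverse regression of `X` on `Y`, based
on the first `N` observations (stored as columns). -/
def Ahat {Ω : Type*} (X : ℕ → Ω → EuclideanSpace ℝ (Fin D))
    (Y : ℕ → Ω → EuclideanSpace ℝ (Fin L)) (N : ℕ) (ω : Ω) : Matrix (Fin D) (Fin L) ℝ :=
  dataMatrix X N ω * (dataMatrix Y N ω)ᵀ * (dataMatrix Y N ω * (dataMatrix Y N ω)ᵀ)⁻¹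

/-- The commutation matrix `T`, characterised by `T vec(M) = vec(Mᵀ)` for every `L × D` matrix
`M`. -/
def commutation (L D : ℕ) : Matrix (Fin L × Fin D) (Fin D × Fin L) ℝ :=
  Matrix.of fun p q => if p.1 = q.2 ∧ p.2 = q.1 then 1 else 0

theorem commutation_mulVec_vec (M : Matrix (Fin L) (Fin D) ℝ) :
    commutation L D *ᵥ M.vec = Mᵀ.vec := by
  ext ⟨l, d⟩
  simp only [Matrix.mulVec, dotProduct, commutation, Matrix.of_apply, Matrix.vec,
    Fintype.sum_prod_type, ite_mul, one_mul, zero_mul, Matrix.transpose_apply]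
  rw [Finset.sum_eq_single d, Finset.sum_eq_single l] <;> simp +contextual [eq_comm]

/-- The differential `Dg(A)` of `g` in closed form. -/
def dgFormula (Γ : Matrix (Fin L) (Fin L) ℝ) (S : Matrix (Fin D) (Fin D) ℝ)
    (A H : Matrix (Fin D) (Fin L) ℝ) : Matrix (Fin L) (Fin D) ℝ :=
  sigmaStar Γ S A * Hᵀ * S⁻¹ - sigmaStar Γ S A * Hᵀ * S⁻¹ * A * g Γ S A
    - g Γ S A * H * g Γ S A

/-- The cross term of the asymptotic covariance. Its middle factor, the transposed commutation
matrix, is the inverse of the commutation matrix. -/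
def crossTerm (Γ : Matrix (Fin L) (Fin L) ℝ) (S : Matrix (Fin D) (Fin D) ℝ)
    (A : Matrix (Fin D) (Fin L) ℝ) : Matrix (Fin D × Fin L) (Fin D × Fin L) ℝ :=
  (((1 : Matrix (Fin D) (Fin D) ℝ) - (g Γ S A)ᵀ * Aᵀ) ⊗ₖ (sigmaStar Γ S A * Γ⁻¹)) *
    (commutation L D)ᵀ * (g Γ S A ⊗ₖ (g Γ S A)ᵀ)

/-- The explicit asymptotic covariance matrix `Θ(A)` of `√N vec(Â⋆)`. -/
def Theta (Γ : Matrix (Fin L) (Fin L) ℝ) (S : Matrix (Fin D) (Fin D) ℝ)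
    (A : Matrix (Fin D) (Fin L) ℝ) : Matrix (Fin D × Fin L) (Fin D × Fin L) ℝ :=
  (S⁻¹ + (g Γ S A)ᵀ * Aᵀ * S⁻¹ * A * g Γ S A - (2 : ℝ) • (S⁻¹ * A * g Γ S A)) ⊗ₖ
      (sigmaStar Γ S A * Γ⁻¹ * sigmaStar Γ S A)
    + ((g Γ S A)ᵀ * Γ⁻¹ * g Γ S A) ⊗ₖ (g Γ S A * S * (g Γ S A)ᵀ)
    - crossTerm Γ S A - (crossTerm Γ S A)ᵀ

/-- The vectorization of a matrix (columns stacked) as a Euclidean vector. -/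
def evec {m n : ℕ} (M : Matrix (Fin m) (Fin n) ℝ) : EuclideanSpace ℝ (Fin n × Fin m) :=
  WithLp.toLp 2 M.vec

/-- The matrix with a given vectorization. -/
def unvec {m n : ℕ} (z : EuclideanSpace ℝ (Fin n × Fin m)) : Matrix (Fin m) (Fin n) ℝ :=
  Matrix.of fun i j => z (j, i)

/-- The statistic `N (vec Â⋆ - vec A⋆)ᵀ Θ(Â)⁻¹ (vec Â⋆ - vec A⋆)`. -/
def quadStat {Ω : Type*} (Γ : Matrix (Fin L) (Fin L) ℝ) (S : Matrix (Fin D) (Fin D) ℝ)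
    (A : Matrix (Fin D) (Fin L) ℝ) (X : ℕ → Ω → EuclideanSpace ℝ (Fin D))
    (Y : ℕ → Ω → EuclideanSpace ℝ (Fin L)) (N : ℕ) (ω : Ω) : ℝ :=
  (N : ℝ) * (((g Γ S (Ahat X Y N ω)).vec - (g Γ S A).vec) ⬝ᵥ
    ((Theta Γ S (Ahat X Y N ω))⁻¹ *ᵥ ((g Γ S (Ahat X Y N ω)).vec - (g Γ S A).vec)))

/-- The chi-square distribution with `k` degrees of freedom: the law of the sum of the squares of
`k` independent standard Gaussian variables. -/
def chiSquare (k : ℕ) : Measure ℝ :=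
  (Measure.pi fun _ : Fin k => gaussianReal 0 1).map fun z => ∑ i, z i ^ 2

instance (k : ℕ) : IsProbabilityMeasure (chiSquare k) :=
  Measure.isProbabilityMeasure_map (Measurable.aemeasurable (by fun_prop))

end InverseRegression

end

noncomputable section

namespace InverseRegression

/-! ### Matrix identities, the differential of `g`, and the factorization of `Theta`. -/

section Algebra

variable {L D : ℕ} {Γ : Matrix (Fin L) (Fin L) ℝ} {S : Matrix (Fin D) (Fin D) ℝ}

/-! The starred parameters are exactly those for which the forward model has the joint Gaussian law
of the inverse regression `Y ∼ N(0, Γ)`, `X = A Y + N(0, Σ)`. So `Y` has covariance `Γ`, while the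
residual `X - A Y` has covariance `Σ` and is uncorrelated with `Y`, hence independent of it by joint
Gaussianity (`indepFun_resid_Y`). The scores `vec ((X - A Y) Yᵀ)` are then i.i.d., centered, with
covariance `Γ ⊗ Σ`. Whenever `Y Yᵀ / N` is invertible, `Â - A` is the averaged score times its
inverse (`Ahat_sub`). The central limit theorem, the law of large numbers and Slutsky's lemma give
the limit `N(0, Γ⁻¹ ⊗ Σ)`, and `Â → A` almost surely.

The passage to `g` rests on `g_sub_g`: the increment `g B - g A` is exactly linear in `B - A`, with
coefficients continuous in `B`. This yields the differential, and it makes `√N (g Â - g A)` a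
continuous function of the pair `(√N (Â - A), Â)`, so that Slutsky's lemma replaces the delta
method. The limit is `Dg(A).Z`, with covariance `J (Γ⁻¹ ⊗ Σ) Jᵀ` for `J = dgMatrix`; expanding this
product gives `Theta` (`dgMatrix_mul_mul_transpose`).

Consistency of the plug-in covariance is continuity of `Theta`. The chi-square limit is one more
application of Slutsky's lemma, followed by whitening the Gaussian limit
(`map_quadratic_multivariateGaussian`). -/

theorem posDef_precision (hΓ : Γ.PosDef) (hS : S.PosDef) (B : Matrix (Fin D) (Fin L) ℝ) :
    (Γ⁻¹ + Bᵀ * S⁻¹ * B).PosDef := by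
  refine hΓ.inv.add_posSemidef ?_
  simpa [Matrix.conjTranspose_eq_transpose_of_trivial] using
    hS.inv.posSemidef.conjTranspose_mul_mul_same B

theorem isUnit_det_precision (hΓ : Γ.PosDef) (hS : S.PosDef) (B : Matrix (Fin D) (Fin L) ℝ) :
    IsUnit (Γ⁻¹ + Bᵀ * S⁻¹ * B).det :=
  (posDef_precision hΓ hS B).det_pos.ne'.isUnit

theorem transpose_eq_of_posDef {n : ℕ} {M : Matrix (Fin n) (Fin n) ℝ} (hM : M.PosDef) :
    Mᵀ = M := by
  simpa [Matrix.conjTranspose_eq_transpose_of_trivial] using hM.isHermitian.eq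

theorem posDef_sigmaStar (hΓ : Γ.PosDef) (hS : S.PosDef) (B : Matrix (Fin D) (Fin L) ℝ) :
    (sigmaStar Γ S B).PosDef :=
  (posDef_precision hΓ hS B).inv

theorem sigmaStar_mul_precision (hΓ : Γ.PosDef) (hS : S.PosDef) (B : Matrix (Fin D) (Fin L) ℝ) :
    sigmaStar Γ S B * (Γ⁻¹ + Bᵀ * S⁻¹ * B) = 1 :=
  Matrix.nonsing_inv_mul _ (isUnit_det_precision hΓ hS B)

theorem precision_mul_sigmaStar (hΓ : Γ.PosDef) (hS : S.PosDef) (B : Matrix (Fin D) (Fin L) ℝ) :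
    (Γ⁻¹ + Bᵀ * S⁻¹ * B) * sigmaStar Γ S B = 1 :=
  Matrix.mul_nonsing_inv _ (isUnit_det_precision hΓ hS B)

theorem g_eq (B : Matrix (Fin D) (Fin L) ℝ) : g Γ S B = sigmaStar Γ S B * Bᵀ * S⁻¹ := rfl

theorem g_transpose (hΓ : Γ.PosDef) (hS : S.PosDef) (B : Matrix (Fin D) (Fin L) ℝ) :
    (g Γ S B)ᵀ = S⁻¹ * B * sigmaStar Γ S B := by
  rw [g_eq, Matrix.transpose_mul, Matrix.transpose_mul, Matrix.transpose_transpose,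
    transpose_eq_of_posDef hS.inv, transpose_eq_of_posDef (posDef_sigmaStar hΓ hS B),
    Matrix.mul_assoc]

/-- The increment `g B - g A` written as a linear function of `H = B - A`, with coefficients
depending continuously on `B`. -/
def gIncrement (Γ : Matrix (Fin L) (Fin L) ℝ) (S : Matrix (Fin D) (Fin D) ℝ)
    (A B H : Matrix (Fin D) (Fin L) ℝ) : Matrix (Fin L) (Fin D) ℝ :=
  sigmaStar Γ S B * Hᵀ * S⁻¹ - sigmaStar Γ S B * Hᵀ * S⁻¹ * A * g Γ S A - g Γ S B * H * g Γ S A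

/-- Write `g A = Σ⋆_B (Γ⁻¹ + Bᵀ Σ⁻¹ B) g A` and eliminate `Γ⁻¹ g A` through the normal equation
`(Γ⁻¹ + Aᵀ Σ⁻¹ A) g A = Aᵀ Σ⁻¹`. There is no remainder term. -/
theorem g_sub_g (hΓ : Γ.PosDef) (hS : S.PosDef) (A B : Matrix (Fin D) (Fin L) ℝ) :
    g Γ S B - g Γ S A = gIncrement Γ S A B (B - A) := by
  have hA : (Γ⁻¹ + Aᵀ * S⁻¹ * A) * g Γ S A = Aᵀ * S⁻¹ := by
    rw [g_eq, ← Matrix.mul_assoc, ← Matrix.mul_assoc, precision_mul_sigmaStar hΓ hS, Matrix.one_mul]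
  have hB := sigmaStar_mul_precision hΓ hS B
  have key : g Γ S A = sigmaStar Γ S B * (Γ⁻¹ + Bᵀ * S⁻¹ * B) * g Γ S A := by
    rw [hB, Matrix.one_mul]
  have hA' : Γ⁻¹ * g Γ S A = Aᵀ * S⁻¹ - Aᵀ * S⁻¹ * A * g Γ S A := by
    rw [eq_sub_iff_add_eq, ← Matrix.add_mul, hA]
  have key' : g Γ S A = sigmaStar Γ S B * (Aᵀ * S⁻¹ - Aᵀ * S⁻¹ * A * g Γ S A)
      + g Γ S B * B * g Γ S A := by
    rw [← hA', g_eq B]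
    nth_rw 1 [key]
    simp only [Matrix.mul_add, Matrix.add_mul, Matrix.mul_assoc]
  refine (congrArg (g Γ S B - ·) key').trans ?_
  rw [gIncrement]
  simp only [Matrix.transpose_sub, Matrix.mul_sub, Matrix.sub_mul, g_eq B, Matrix.mul_assoc]
  abel

/-- In the forward model the left side is `Cov(Y, X)`; the right side is its value in the inverse
model. -/
theorem g_mul_gammaStar (hΓ : Γ.PosDef) (hS : S.PosDef) (A : Matrix (Fin D) (Fin L) ℝ) :
    g Γ S A * gammaStar Γ S A = Γ * Aᵀ := by
  have h1 : S⁻¹ * S = 1 := Matrix.nonsing_inv_mul _ hS.det_pos.ne'.isUnit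
  have h2 : Γ⁻¹ * Γ = 1 := Matrix.nonsing_inv_mul _ hΓ.det_pos.ne'.isUnit
  have : Aᵀ * S⁻¹ * gammaStar Γ S A = (Γ⁻¹ + Aᵀ * S⁻¹ * A) * (Γ * Aᵀ) := by
    rw [gammaStar, Matrix.mul_add, Matrix.add_mul, Matrix.mul_assoc Aᵀ S⁻¹ S, h1, Matrix.mul_one,
      ← Matrix.mul_assoc Γ⁻¹, h2, Matrix.one_mul]
    simp only [Matrix.mul_assoc]
  rw [g_eq, Matrix.mul_assoc, Matrix.mul_assoc, ← Matrix.mul_assoc Aᵀ, this, ← Matrix.mul_assoc,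
    sigmaStar_mul_precision hΓ hS, Matrix.one_mul]

/-- Total variance of `Y`: the part explained by `X` plus the noise part. -/
theorem g_mul_gammaStar_mul_g_transpose_add (hΓ : Γ.PosDef) (hS : S.PosDef)
    (A : Matrix (Fin D) (Fin L) ℝ) :
    g Γ S A * gammaStar Γ S A * (g Γ S A)ᵀ + sigmaStar Γ S A = Γ := by
  have h2 : Γ * Γ⁻¹ = 1 := Matrix.mul_nonsing_inv _ hΓ.det_pos.ne'.isUnit
  calc _ = Γ * ((Γ⁻¹ + Aᵀ * S⁻¹ * A) * sigmaStar Γ S A) := by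
        rw [g_mul_gammaStar hΓ hS, g_transpose hΓ hS, add_mul, mul_add, ← Matrix.mul_assoc Γ Γ⁻¹, h2,
          one_mul, add_comm]
        simp only [Matrix.mul_assoc]
    _ = Γ := by rw [precision_mul_sigmaStar hΓ hS, mul_one]

theorem posDef_gammaStar (hΓ : Γ.PosDef) (hS : S.PosDef) (A : Matrix (Fin D) (Fin L) ℝ) :
    (gammaStar Γ S A).PosDef := by
  refine hS.add_posSemidef ?_
  simpa [Matrix.conjTranspose_eq_transpose_of_trivial] using
    hΓ.posSemidef.mul_mul_conjTranspose_same A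

theorem continuous_sigmaStar (hΓ : Γ.PosDef) (hS : S.PosDef) :
    Continuous (sigmaStar Γ S) := by
  rw [continuous_iff_continuousAt]
  intro B
  have hf : Continuous fun B : Matrix (Fin D) (Fin L) ℝ => Γ⁻¹ + Bᵀ * S⁻¹ * B := by fun_prop
  refine ContinuousAt.comp (g := fun M : Matrix (Fin L) (Fin L) ℝ => M⁻¹)
    (continuousAt_matrix_inv _ ?_) hf.continuousAt
  have := (posDef_precision hΓ hS B).det_pos.ne'
  simpa [Ring.inverse_eq_inv'] using continuousAt_inv₀ this

theorem continuous_g (hΓ : Γ.PosDef) (hS : S.PosDef) : Continuous (g Γ S) := by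
  have := continuous_sigmaStar hΓ hS
  unfold sigmaStar at this
  unfold g
  fun_prop

theorem continuous_gIncrement (hΓ : Γ.PosDef) (hS : S.PosDef) (A : Matrix (Fin D) (Fin L) ℝ)
    {X : Type*} [TopologicalSpace X] {f h : X → Matrix (Fin D) (Fin L) ℝ} (hf : Continuous f)
    (hh : Continuous h) : Continuous fun x => gIncrement Γ S A (f x) (h x) := by
  have := (continuous_sigmaStar hΓ hS).comp hf
  have := (continuous_g hΓ hS).comp hf
  unfold Function.comp at *
  unfold gIncrement
  fun_prop

theorem continuous_kronecker {X : Type*} [TopologicalSpace X] {a b c d : ℕ}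
    {f : X → Matrix (Fin a) (Fin b) ℝ} {h : X → Matrix (Fin c) (Fin d) ℝ}
    (hf : Continuous f) (hh : Continuous h) : Continuous fun x => f x ⊗ₖ h x :=
  continuous_matrix fun i j => (hf.matrix_elem i.1 j.1).mul (hh.matrix_elem i.2 j.2)

theorem continuous_Theta (hΓ : Γ.PosDef) (hS : S.PosDef) : Continuous (Theta Γ S) := by
  have := continuous_sigmaStar hΓ hS
  have := continuous_g hΓ hS
  have hc : Continuous (crossTerm Γ S) :=
    ((continuous_kronecker (f := fun B => 1 - (g Γ S B)ᵀ * Bᵀ) (h := fun B => sigmaStar Γ S B * Γ⁻¹) (by fun_prop)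
      (by fun_prop)).matrix_mul continuous_const).matrix_mul
      (continuous_kronecker (f := g Γ S) (h := fun B => (g Γ S B)ᵀ) (by fun_prop) (by fun_prop))
  exact (((continuous_kronecker (f := fun B => S⁻¹ + (g Γ S B)ᵀ * Bᵀ * S⁻¹ * B * g Γ S B
      - (2 : ℝ) • (S⁻¹ * B * g Γ S B))
      (h := fun B => sigmaStar Γ S B * Γ⁻¹ * sigmaStar Γ S B) (by fun_prop) (by fun_prop)).add
    (continuous_kronecker (f := fun B => (g Γ S B)ᵀ * Γ⁻¹ * g Γ S B) (h := fun B => g Γ S B * S * (g Γ S B)ᵀ)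
      (by fun_prop) (by fun_prop))).sub hc).sub hc.matrix_transpose

/-- `dgFormula` as a linear map in the direction. -/
def dgLinear (Γ : Matrix (Fin L) (Fin L) ℝ) (S : Matrix (Fin D) (Fin D) ℝ)
    (A : Matrix (Fin D) (Fin L) ℝ) :
    Matrix (Fin D) (Fin L) ℝ →L[ℝ] Matrix (Fin L) (Fin D) ℝ where
  toFun := dgFormula Γ S A
  map_add' H K := by
    simp only [dgFormula, Matrix.transpose_add, Matrix.mul_add, Matrix.add_mul]; abel
  map_smul' c H := by
    simp only [dgFormula, Matrix.transpose_smul, Matrix.mul_smul, Matrix.smul_mul, smul_sub,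
      RingHom.id_apply]
  cont := by unfold dgFormula; fun_prop

section Frobenius

attribute [local instance] Matrix.frobeniusNormedAddCommGroup Matrix.frobeniusNormedSpace

/-- By `g_sub_g`, the error of the linear approximation comes only from replacing the coefficients
at `B` by those at `A`. It is at most `φ B * ‖B - A‖` with `φ` continuous and zero at `A`. The
Frobenius norm is submultiplicative and invariant under transposition. -/
theorem hasFDerivAt_g (hΓ : Γ.PosDef) (hS : S.PosDef) (A : Matrix (Fin D) (Fin L) ℝ) :
    HasFDerivAt (g Γ S) (dgLinear Γ S A) A := by
  refine hasFDerivAt_iff_isLittleO.2 ?_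
  set φ : Matrix (Fin D) (Fin L) ℝ → ℝ := fun B =>
    ‖sigmaStar Γ S B - sigmaStar Γ S A‖ * ‖S⁻¹ - S⁻¹ * A * g Γ S A‖
      + ‖g Γ S B - g Γ S A‖ * ‖g Γ S A‖ with hφ
  have hφ0 : Tendsto φ (𝓝 A) (𝓝 0) := by
    have h1 := continuous_sigmaStar hΓ hS
    have h2 := continuous_g hΓ hS
    have : Continuous φ := by fun_prop
    simpa [hφ] using this.tendsto A
  refine Asymptotics.IsLittleO.of_bound fun c hc => ?_
  filter_upwards [hφ0.eventually_le_const hc] with B hB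
  have h : gIncrement Γ S A B (B - A) - dgFormula Γ S A (B - A)
      = (sigmaStar Γ S B - sigmaStar Γ S A) * (B - A)ᵀ * (S⁻¹ - S⁻¹ * A * g Γ S A)
        - (g Γ S B - g Γ S A) * (B - A) * g Γ S A := by
    simp only [gIncrement, dgFormula, Matrix.mul_sub, Matrix.sub_mul, Matrix.mul_assoc]
    abel
  change ‖g Γ S B - g Γ S A - dgFormula Γ S A (B - A)‖ ≤ c * ‖B - A‖
  rw [g_sub_g hΓ hS A B, h]
  calc _ ≤ ‖(sigmaStar Γ S B - sigmaStar Γ S A) * (B - A)ᵀ * (S⁻¹ - S⁻¹ * A * g Γ S A)‖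
        + ‖(g Γ S B - g Γ S A) * (B - A) * g Γ S A‖ := norm_sub_le _ _
    _ ≤ ‖sigmaStar Γ S B - sigmaStar Γ S A‖ * ‖(B - A)ᵀ‖ * ‖S⁻¹ - S⁻¹ * A * g Γ S A‖
        + ‖g Γ S B - g Γ S A‖ * ‖B - A‖ * ‖g Γ S A‖ := by
      gcongr <;> refine (Matrix.frobenius_norm_mul _ _).trans ?_ <;> gcongr <;>
        exact Matrix.frobenius_norm_mul _ _
    _ = φ B * ‖B - A‖ := by rw [Matrix.frobenius_norm_transpose]; ring
    _ ≤ c * ‖B - A‖ := by gcongr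

end Frobenius

theorem fderiv_g (hΓ : Γ.PosDef) (hS : S.PosDef) (A H : Matrix (Fin D) (Fin L) ℝ) :
    fderiv ℝ (g Γ S) A H = dgFormula Γ S A H := by
  rw [(hasFDerivAt_g hΓ hS A).fderiv]
  rfl

/-- The matrix of the differential of `g` in vectorized coordinates. -/
def dgMatrix (Γ : Matrix (Fin L) (Fin L) ℝ) (S : Matrix (Fin D) (Fin D) ℝ)
    (A : Matrix (Fin D) (Fin L) ℝ) : Matrix (Fin D × Fin L) (Fin L × Fin D) ℝ :=
  ((S⁻¹ - S⁻¹ * A * g Γ S A)ᵀ ⊗ₖ sigmaStar Γ S A) * (commutation L D)ᵀ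
    - (g Γ S A)ᵀ ⊗ₖ g Γ S A

theorem commutation_transpose (L D : ℕ) : (commutation L D)ᵀ = commutation D L := by
  ext p q
  simp only [commutation, Matrix.transpose_apply, Matrix.of_apply]
  congr 1
  simp [eq_comm, and_comm]

theorem dgMatrix_mulVec_vec (A H : Matrix (Fin D) (Fin L) ℝ) :
    dgMatrix Γ S A *ᵥ H.vec = (dgFormula Γ S A H).vec := by
  rw [dgMatrix, Matrix.sub_mulVec, ← Matrix.mulVec_mulVec, commutation_transpose,
    commutation_mulVec_vec, Matrix.kronecker_mulVec_vec, Matrix.kronecker_mulVec_vec,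
    ← Matrix.vec_sub, dgFormula]
  congr 1
  simp only [Matrix.transpose_transpose, Matrix.mul_sub, Matrix.mul_assoc]

/-- Moves the commutation matrix past `Γ⁻¹ ⊗ Σ`, so that adjacent Kronecker products can be
multiplied factorwise. -/
theorem commutation_mul_kronecker (P : Matrix (Fin L) (Fin L) ℝ) (Q : Matrix (Fin D) (Fin D) ℝ) :
    (commutation L D)ᵀ * (P ⊗ₖ Q) = (Q ⊗ₖ P) * (commutation L D)ᵀ := by
  ext ⟨d, l⟩ ⟨l', d'⟩
  simp only [Matrix.mul_apply, Matrix.transpose_apply, commutation, Matrix.of_apply,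
    Matrix.kroneckerMap_apply, Fintype.sum_prod_type, ite_mul, mul_ite, one_mul, zero_mul, mul_one,
    mul_zero]
  rw [Finset.sum_eq_single l, Finset.sum_eq_single d, Finset.sum_eq_single d',
    Finset.sum_eq_single l'] <;> simp +contextual [eq_comm, mul_comm]

theorem commutation_mul_transpose (L D : ℕ) :
    (commutation L D)ᵀ * commutation L D = 1 := by
  ext ⟨d, l⟩ ⟨d', l'⟩
  simp only [Matrix.mul_apply, Matrix.transpose_apply, commutation, Matrix.of_apply,
    Fintype.sum_prod_type, ite_mul, one_mul, zero_mul, Matrix.one_apply]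
  rw [Finset.sum_eq_single l, Finset.sum_eq_single d] <;>
    simp +contextual [eq_comm, and_comm]

/-- `dgMatrix` is a difference of two terms. Their squares give the two Kronecker products in
`Theta`, the mixed products give `crossTerm` and its transpose. -/
theorem dgMatrix_mul_mul_transpose (hΓ : Γ.PosDef) (hS : S.PosDef)
    (A : Matrix (Fin D) (Fin L) ℝ) :
    dgMatrix Γ S A * (Γ⁻¹ ⊗ₖ S) * (dgMatrix Γ S A)ᵀ = Theta Γ S A := by
  have hs : (sigmaStar Γ S A)ᵀ = sigmaStar Γ S A :=
    transpose_eq_of_posDef (posDef_sigmaStar hΓ hS A)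
  have hΓt : Γ⁻¹ᵀ = Γ⁻¹ := transpose_eq_of_posDef hΓ.inv
  have hSt : Sᵀ = S := transpose_eq_of_posDef hS
  have hSt' : S⁻¹ᵀ = S⁻¹ := transpose_eq_of_posDef hS.inv
  have h1 : S⁻¹ * S = 1 := Matrix.nonsing_inv_mul _ hS.det_pos.ne'.isUnit
  set M := S⁻¹ - S⁻¹ * A * g Γ S A with hM
  -- Both sides equal the symmetric matrix `S⁻¹ A Σ⋆ Aᵀ S⁻¹`. This is what lets two mixed terms of
  -- `Mᵀ * S * M` merge into one with factor 2.
  have hsym : (g Γ S A)ᵀ * Aᵀ * S⁻¹ = S⁻¹ * A * g Γ S A := by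
    rw [g_transpose hΓ hS, g_eq]; simp only [Matrix.mul_assoc]
  have hMt : Mᵀ = S⁻¹ - (g Γ S A)ᵀ * Aᵀ * S⁻¹ := by
    rw [hM, Matrix.transpose_sub, Matrix.transpose_mul, Matrix.transpose_mul, hSt',
      Matrix.mul_assoc]
  have hMS : Mᵀ * S = 1 - (g Γ S A)ᵀ * Aᵀ := by
    rw [hMt, Matrix.sub_mul, h1, Matrix.mul_assoc, h1, Matrix.mul_one]
  have h3 : (g Γ S A)ᵀ * Aᵀ * (S⁻¹ * A * g Γ S A) = S⁻¹ * A * g Γ S A * A * g Γ S A := by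
    simp only [← Matrix.mul_assoc, hsym]
  have hMSM : Mᵀ * S * M = S⁻¹ + (g Γ S A)ᵀ * Aᵀ * S⁻¹ * A * g Γ S A
      - (2 : ℝ) • (S⁻¹ * A * g Γ S A) := by
    rw [hMS, hM, Matrix.sub_mul, Matrix.one_mul, Matrix.mul_sub, hsym, two_smul, h3]
    abel
  set T := commutation L D with hT
  set G := g Γ S A with hG
  set s := sigmaStar Γ S A
  have e1 : ((Mᵀ ⊗ₖ s) * Tᵀ) * (Γ⁻¹ ⊗ₖ S) = ((Mᵀ * S) ⊗ₖ (s * Γ⁻¹)) * Tᵀ := by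
    rw [Matrix.mul_assoc, commutation_mul_kronecker, ← Matrix.mul_assoc,
      ← Matrix.mul_kronecker_mul]
  have hcross : crossTerm Γ S A = ((Mᵀ ⊗ₖ s) * Tᵀ) * (Γ⁻¹ ⊗ₖ S) * (G ⊗ₖ Gᵀ) := by
    rw [e1, hMS]; rfl
  have t1 : ((Mᵀ ⊗ₖ s) * Tᵀ)ᵀ = T * (M ⊗ₖ s) := by
    rw [Matrix.transpose_mul, Matrix.transpose_transpose, ← Matrix.kroneckerMap_transpose,
      Matrix.transpose_transpose, hs]
  have t2 : (Gᵀ ⊗ₖ G)ᵀ = G ⊗ₖ Gᵀ := by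
    rw [← Matrix.kroneckerMap_transpose, Matrix.transpose_transpose]
  have tC : (Γ⁻¹ ⊗ₖ S)ᵀ = Γ⁻¹ ⊗ₖ S := by rw [← Matrix.kroneckerMap_transpose, hΓt, hSt]
  have hcrosst : (crossTerm Γ S A)ᵀ = (Gᵀ ⊗ₖ G) * (Γ⁻¹ ⊗ₖ S) * (T * (M ⊗ₖ s)) := by
    rw [hcross, Matrix.transpose_mul, Matrix.transpose_mul, t1, tC, ← t2,
      Matrix.transpose_transpose, Matrix.mul_assoc]
  have e2 : ((Mᵀ ⊗ₖ s) * Tᵀ) * (Γ⁻¹ ⊗ₖ S) * (T * (M ⊗ₖ s)) = (Mᵀ * S * M) ⊗ₖ (s * Γ⁻¹ * s) := by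
    rw [e1, Matrix.mul_assoc, ← Matrix.mul_assoc Tᵀ, commutation_mul_transpose, Matrix.one_mul,
      ← Matrix.mul_kronecker_mul]
  have e3 : (Gᵀ ⊗ₖ G) * (Γ⁻¹ ⊗ₖ S) * (G ⊗ₖ Gᵀ) = (Gᵀ * Γ⁻¹ * G) ⊗ₖ (G * S * Gᵀ) := by
    rw [← Matrix.mul_kronecker_mul, ← Matrix.mul_kronecker_mul]
  change ((Mᵀ ⊗ₖ s) * Tᵀ - Gᵀ ⊗ₖ G) * (Γ⁻¹ ⊗ₖ S) * ((Mᵀ ⊗ₖ s) * Tᵀ - Gᵀ ⊗ₖ G)ᵀ = _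
  rw [Matrix.transpose_sub (_ * Tᵀ), t1, t2, Matrix.sub_mul, Matrix.sub_mul, Matrix.mul_sub,
    Matrix.mul_sub, e2, e3, ← hcross, ← hcrosst, hMSM, Theta]
  abel

theorem posSemidef_Theta (hΓ : Γ.PosDef) (hS : S.PosDef) (A : Matrix (Fin D) (Fin L) ℝ) :
    (Theta Γ S A).PosSemidef := by
  rw [← dgMatrix_mul_mul_transpose hΓ hS]
  simpa [Matrix.conjTranspose_eq_transpose_of_trivial] using
    (hΓ.inv.kronecker hS).posSemidef.mul_mul_conjTranspose_same (dgMatrix Γ S A)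

end Algebra

/-! ### Vectorization and its inverse. -/

section Vectorization

variable {m n : ℕ}

theorem evec_sub (M N : Matrix (Fin m) (Fin n) ℝ) : evec (M - N) = evec M - evec N := rfl

theorem evec_smul (c : ℝ) (M : Matrix (Fin m) (Fin n) ℝ) : evec (c • M) = c • evec M := rfl

@[fun_prop]
theorem continuous_evec : Continuous (evec : Matrix (Fin m) (Fin n) ℝ → _) :=
  (PiLp.continuous_toLp 2 _).comp (continuous_pi fun p => continuous_id.matrix_elem p.2 p.1)

@[fun_prop]
theorem continuous_unvec :
    Continuous (unvec : EuclideanSpace ℝ (Fin n × Fin m) → Matrix (Fin m) (Fin n) ℝ) :=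
  continuous_matrix fun i j => by unfold unvec; fun_prop

end Vectorization

/-! ### Convergence in distribution, linear images of Gaussians, and the chi-square law. -/

section Distribution

variable {Ω : Type*} [MeasurableSpace Ω] {μ : Measure Ω} [IsProbabilityMeasure μ]

/-- Only the law of the limit matters. This turns the limit produced by Slutsky's lemma, a function
of a Gaussian vector, into an explicitly named law. -/
theorem tendstoInDistribution_id_of_map_eq {Ω' E : Type*} [MeasurableSpace Ω']
    [TopologicalSpace E] [MeasurableSpace E] [OpensMeasurableSpace E]
    {μ' : Measure Ω'} [IsProbabilityMeasure μ'] {ν : Measure E} [IsProbabilityMeasure ν]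
    {X : ℕ → Ω → E} {Z : Ω' → E}
    (h : TendstoInDistribution X atTop Z (fun _ => μ) μ') (hmap : μ'.map Z = ν) :
    TendstoInDistribution X atTop id (fun _ => μ) ν where
  forall_aemeasurable := h.forall_aemeasurable
  tendsto := by
    have h' := h.tendsto
    have : (⟨ν.map id, Measure.isProbabilityMeasure_map aemeasurable_id⟩ : ProbabilityMeasure E)
        = ⟨μ'.map Z, Measure.isProbabilityMeasure_map h.aemeasurable_limit⟩ :=
      Subtype.ext (by simp [hmap])
    rw [this]
    exact h'

theorem charFun_map_toLp_mulVec {ι κ : Type*} [Fintype ι] [Fintype κ]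
    (ν : Measure (EuclideanSpace ℝ ι)) (K : Matrix κ ι ℝ) (t : EuclideanSpace ℝ κ) :
    charFun (ν.map fun z => WithLp.toLp 2 (K *ᵥ z.ofLp)) t
      = charFun ν (WithLp.toLp 2 (Kᵀ *ᵥ t.ofLp)) := by
  rw [charFun_apply, charFun_apply, integral_map (Measurable.aemeasurable (by fun_prop))
    (Continuous.aestronglyMeasurable (by fun_prop))]
  congr 1
  ext z
  congr 3
  rw [EuclideanSpace.inner_eq_star_dotProduct, EuclideanSpace.inner_eq_star_dotProduct]
  simp [Matrix.dotProduct_mulVec, Matrix.mulVec_transpose]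

/-- Comparing characteristic functions requires no density, so singular covariances are covered;
`Theta` may be singular. -/
theorem map_multivariateGaussian_mulVec {ι κ : Type*} [Fintype ι] [Fintype κ] [DecidableEq ι]
    [DecidableEq κ] {C : Matrix ι ι ℝ} (hC : C.PosSemidef) (K : Matrix κ ι ℝ) :
    (multivariateGaussian 0 C).map (fun z => WithLp.toLp 2 (K *ᵥ z.ofLp))
      = multivariateGaussian 0 (K * C * Kᵀ) := by
  have hK : (K * C * Kᵀ).PosSemidef := by
    simpa [Matrix.conjTranspose_eq_transpose_of_trivial] using hC.mul_mul_conjTranspose_same K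
  have : IsProbabilityMeasure
      ((multivariateGaussian 0 C).map fun z => WithLp.toLp 2 (K *ᵥ z.ofLp)) :=
    Measure.isProbabilityMeasure_map (Measurable.aemeasurable (by fun_prop))
  refine Measure.ext_of_charFun ?_
  ext t
  rw [charFun_map_toLp_mulVec, charFun_multivariateGaussian hC, charFun_multivariateGaussian hK]
  congr 3
  · simp
  · norm_cast
    simp only [← Matrix.mulVec_mulVec]
    rw [Matrix.dotProduct_mulVec t.ofLp K, Matrix.mulVec_transpose]

theorem covariance_mulVec_multivariateGaussian {ι κ κ' : Type*} [Fintype ι] [DecidableEq ι]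
    {C : Matrix ι ι ℝ} (hC : C.PosSemidef) (K : Matrix κ ι ℝ) (K' : Matrix κ' ι ℝ) (p : κ)
    (q : κ') :
    cov[fun z => (K *ᵥ z.ofLp) p, fun z => (K' *ᵥ z.ofLp) q; multivariateGaussian 0 C]
      = (K * C * K'ᵀ) p q := by
  have h := covarianceBilin_apply_eq_cov (μ := multivariateGaussian 0 C)
    IsGaussian.memLp_two_id (WithLp.toLp 2 (K p)) (WithLp.toLp 2 (K' q))
  rw [covarianceBilin_multivariateGaussian hC] at h
  have e (a : ι → ℝ) : (fun z : EuclideanSpace ℝ ι => a ⬝ᵥ z.ofLp)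
      = fun z => inner ℝ (WithLp.toLp 2 a) z := by
    ext z
    rw [EuclideanSpace.inner_eq_star_dotProduct, dotProduct_comm]
    simp
  change cov[fun z : EuclideanSpace ℝ ι => K p ⬝ᵥ z.ofLp, fun z => K' q ⬝ᵥ z.ofLp; _] = _
  rw [e, e, ← h, Matrix.mul_assoc]
  rfl

/-- The multivariate central limit theorem for centered i.i.d. random vectors. -/
theorem tendstoInDistribution_inv_sqrt_smul_sum {ι : Type*} [Fintype ι] [DecidableEq ι]
    {ξ : ℕ → Ω → EuclideanSpace ℝ ι} {C : Matrix ι ι ℝ} (hC : C.PosSemidef)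
    (hindep : iIndepFun ξ μ) (hident : ∀ i, IdentDistrib (ξ i) (ξ 0) μ μ)
    (hL2 : MemLp (ξ 0) 2 μ) (hmean : ∀ t, ∫ ω, inner ℝ (ξ 0 ω) t ∂μ = 0)
    (hvar : ∀ t : EuclideanSpace ℝ ι, ∫ ω, inner ℝ (ξ 0 ω) t ^ 2 ∂μ = t ⬝ᵥ C *ᵥ t) :
    TendstoInDistribution (fun (N : ℕ) ω => (√(N : ℝ))⁻¹ • ∑ k ∈ Finset.range N, ξ k ω)
      atTop id (fun _ => μ) (multivariateGaussian 0 C) where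
  forall_aemeasurable N :=
    AEMeasurable.fun_const_smul
      (Finset.aemeasurable_fun_sum _ fun i _ => (hident i).aemeasurable_fst) _
  tendsto := by
    refine ProbabilityMeasure.tendsto_iff_tendsto_charFun.2 fun t => ?_
    have hmeas : Measurable fun x : EuclideanSpace ℝ ι => inner ℝ x t := by fun_prop
    set v : ℝ := t ⬝ᵥ C *ᵥ t with hv
    have hξ := (hident 0).aemeasurable_fst
    have hVar : Var[fun ω => inner ℝ (ξ 0 ω) t; μ] = v := by
      have hm : AEMeasurable (fun ω => inner ℝ (ξ 0 ω) t) μ := hmeas.comp_aemeasurable hξ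
      rw [variance_eq_integral hm, hmean t]
      simpa using hvar t
    have hv0 : 0 ≤ v := hVar ▸ variance_nonneg _ _
    -- Cramér–Wold: the scalar theorem is applied to the projection on `t`, and its characteristic
    -- function at 1 is the vector one at `t`.
    have hclt := tendstoInDistribution_inv_sqrt_mul_sum_sub (P := μ)
      (X := fun i ω => inner ℝ (ξ i ω) t)
      (P' := gaussianReal 0 Var[fun ω => inner ℝ (ξ 0 ω) t; μ].toNNReal) (Y := id)
      ⟨aemeasurable_id, by simp⟩ (hL2.inner_const t) (hindep.comp (fun _ x => inner ℝ x t)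
        fun _ => hmeas) (fun i => (hident i).comp hmeas)
    have h1 := ProbabilityMeasure.tendsto_iff_tendsto_charFun.1 hclt.tendsto 1
    have e1 : charFun ((multivariateGaussian 0 C).map id) t
        = charFun ((gaussianReal 0 Var[fun ω => inner ℝ (ξ 0 ω) t; μ].toNNReal).map id) 1 := by
      rw [Measure.map_id, Measure.map_id, charFun_multivariateGaussian hC, charFun_gaussianReal,
        hVar, Real.coe_toNNReal _ hv0]
      simp [hv]
    have e2 (N : ℕ) : charFun (μ.map fun ω => (√(N : ℝ))⁻¹ • ∑ k ∈ Finset.range N, ξ k ω) t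
        = charFun (μ.map fun ω => (√(N : ℝ))⁻¹ * (∑ k ∈ Finset.range N, inner ℝ (ξ k ω) t
          - N * μ[fun ω => inner ℝ (ξ 0 ω) t])) 1 := by
      have m1 : AEMeasurable (fun ω => (√(N : ℝ))⁻¹ • ∑ k ∈ Finset.range N, ξ k ω) μ :=
        AEMeasurable.fun_const_smul
          (Finset.aemeasurable_fun_sum _ fun i _ => (hident i).aemeasurable_fst) _
      have m2 := hclt.forall_aemeasurable N
      rw [charFun_apply, charFun_apply, integral_map m1 (by fun_prop), integral_map m2 (by fun_prop)]
      simp [hmean, inner_smul_left, sum_inner]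
    simpa only [ProbabilityMeasure.coe_mk, e1, e2] using h1

open scoped MatrixOrder in
-- With `s = √C`, the Gaussian vector is `s x` for a standard Gaussian `x`, and `s C⁻¹ s = 1`
-- reduces the form to `∑ xᵢ²`. The bijection `e` only counts the degrees of freedom.
theorem map_quadratic_multivariateGaussian {ι : Type*} [Fintype ι] [DecidableEq ι]
    {C : Matrix ι ι ℝ} (hC : C.PosDef) {k : ℕ} (e : Fin k ≃ ι) :
    (multivariateGaussian 0 C).map (fun z => z.ofLp ⬝ᵥ (C⁻¹ *ᵥ z.ofLp)) = chiSquare k := by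
  set s := CFC.sqrt C with hs
  have hss : s * s = C := CFC.sqrt_mul_sqrt_self _ hC.posSemidef.nonneg
  have hst : sᵀ = s := by
    have : s.IsHermitian := (CFC.sqrt_nonneg C).isSelfAdjoint
    simpa [Matrix.conjTranspose_eq_transpose_of_trivial] using this.eq
  have hdet : IsUnit s.det := by
    have := hC.det_pos.ne'
    rw [← hss, Matrix.det_mul] at this
    exact (left_ne_zero_of_mul this).isUnit
  have hq (x : ι → ℝ) : (s *ᵥ x) ⬝ᵥ (C⁻¹ *ᵥ (s *ᵥ x)) = ∑ i, x i ^ 2 := by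
    rw [← hss, Matrix.mul_inv_rev, Matrix.mulVec_mulVec, Matrix.mul_assoc,
      Matrix.nonsing_inv_mul _ hdet, Matrix.mul_one, Matrix.dotProduct_mulVec,
      ← Matrix.mulVec_transpose, Matrix.mulVec_mulVec, Matrix.transpose_nonsing_inv, hst,
      Matrix.nonsing_inv_mul _ hdet, Matrix.one_mulVec]
    simp [dotProduct, sq]
  have hpi : (Measure.pi fun _ : Fin k => gaussianReal 0 1).map (MeasurableEquiv.piCongrLeft
      (fun _ => ℝ) e) = Measure.pi fun _ : ι => gaussianReal 0 1 :=
    (measurePreserving_piCongrLeft (fun _ : ι => gaussianReal 0 1) e).map_eq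
  rw [multivariateGaussian, Measure.map_map (by fun_prop) (by fun_prop), ← map_pi_eq_stdGaussian,
    Measure.map_map (by fun_prop) (by fun_prop), ← hpi, Measure.map_map (by fun_prop) (by fun_prop),
    chiSquare]
  congr 1
  ext x
  simp only [Function.comp_apply, zero_add, Matrix.ofLp_toEuclideanCLM]
  rw [hq, ← e.sum_comp]
  refine Finset.sum_congr rfl fun i _ => ?_
  rw [MeasurableEquiv.coe_piCongrLeft, Equiv.piCongrLeft_apply_apply]

end Distribution

/-! ### Second moments of linear images of independent Gaussian vectors. -/

section Gaussian

variable {Ω : Type*} [MeasurableSpace Ω] {μ : Measure Ω}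
  {ι ι' κ κ' : Type*} [Fintype ι] [Fintype ι'] [DecidableEq ι] [DecidableEq ι']
  {V : Ω → EuclideanSpace ℝ ι} {W : Ω → EuclideanSpace ℝ ι'}
  {C : Matrix ι ι ℝ} {C' : Matrix ι' ι' ℝ}

theorem memLp_mulVec_of_hasLaw (hV : HasLaw V (multivariateGaussian 0 C) μ) (P : Matrix κ ι ℝ)
    (i : κ) : MemLp (fun ω => (P *ᵥ (V ω).ofLp) i) 2 μ := by
  simp only [Matrix.mulVec, dotProduct]
  exact memLp_finsetSum _ fun j _ => (hV.hasGaussianLaw.memLp_two.eval_piLp j).const_mul _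

theorem integral_mulVec_of_hasLaw (hV : HasLaw V (multivariateGaussian 0 C) μ) (P : Matrix κ ι ℝ)
    (i : κ) : ∫ ω, (P *ᵥ (V ω).ofLp) i ∂μ = 0 := by
  have hint := hV.hasGaussianLaw.integrable
  have h0 (j : ι) : ∫ ω, V ω j ∂μ = 0 := by
    have h1 : ∫ ω, V ω ∂μ = 0 := by
      rw [hV.integral_eq]; simp
    have h2 := (EuclideanSpace.proj (𝕜 := ℝ) j).integral_comp_comm hint
    rw [h1] at h2
    simpa using h2
  simp only [Matrix.mulVec, dotProduct]
  rw [integral_finsetSum _ fun j _ => (hint.eval_piLp j).const_mul _]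
  simp [integral_const_mul, h0]

theorem covariance_mulVec_of_hasLaw (hC : C.PosSemidef)
    (hV : HasLaw V (multivariateGaussian 0 C) μ) (P : Matrix κ ι ℝ) (P' : Matrix κ' ι ℝ)
    (i : κ) (j : κ') :
    cov[fun ω => (P *ᵥ (V ω).ofLp) i, fun ω => (P' *ᵥ (V ω).ofLp) j; μ] = (P * C * P'ᵀ) i j := by
  rw [← covariance_mulVec_multivariateGaussian hC P P' i j]
  refine hV.covariance_fun_comp (f := fun z => (P *ᵥ z.ofLp) i) (g := fun z => (P' *ᵥ z.ofLp) j)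
    ?_ ?_ <;> exact Continuous.aemeasurable (by fun_prop)

theorem covariance_mulVec_of_indepFun
    (hV : HasLaw V (multivariateGaussian 0 C) μ) (hW : HasLaw W (multivariateGaussian 0 C') μ)
    (hVW : IndepFun V W μ) (P : Matrix κ ι ℝ) (Q : Matrix κ' ι' ℝ) (i : κ) (j : κ') :
    cov[fun ω => (P *ᵥ (V ω).ofLp) i, fun ω => (Q *ᵥ (W ω).ofLp) j; μ] = 0 := by
  have h : IndepFun (fun ω => (P *ᵥ (V ω).ofLp) i) (fun ω => (Q *ᵥ (W ω).ofLp) j) μ :=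
    hVW.comp (φ := fun z : EuclideanSpace ℝ ι => (P *ᵥ z.ofLp) i)
      (ψ := fun z : EuclideanSpace ℝ ι' => (Q *ᵥ z.ofLp) j)
      (Continuous.measurable (by fun_prop)) (Continuous.measurable (by fun_prop))
  exact h.covariance_eq_zero (memLp_mulVec_of_hasLaw hV P i) (memLp_mulVec_of_hasLaw hW Q j)

variable [IsProbabilityMeasure μ]

theorem covariance_mulVec_add_of_indepFun (hC : C.PosSemidef) (hC' : C'.PosSemidef)
    (hV : HasLaw V (multivariateGaussian 0 C) μ) (hW : HasLaw W (multivariateGaussian 0 C') μ)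
    (hVW : IndepFun V W μ) (P : Matrix κ ι ℝ) (Q : Matrix κ ι' ℝ) (P' : Matrix κ' ι ℝ)
    (Q' : Matrix κ' ι' ℝ) (i : κ) (j : κ') :
    cov[fun ω => (P *ᵥ (V ω).ofLp) i + (Q *ᵥ (W ω).ofLp) i,
        fun ω => (P' *ᵥ (V ω).ofLp) j + (Q' *ᵥ (W ω).ofLp) j; μ]
      = (P * C * P'ᵀ + Q * C' * Q'ᵀ) i j := by
  have mP := memLp_mulVec_of_hasLaw hV P i
  have mP' := memLp_mulVec_of_hasLaw hV P' j
  have mQ := memLp_mulVec_of_hasLaw hW Q i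
  have mQ' := memLp_mulVec_of_hasLaw hW Q' j
  have hi1 := covariance_mulVec_of_indepFun hV hW hVW P Q' i j
  have hi2 := covariance_mulVec_of_indepFun hV hW hVW P' Q j i
  have h := covariance_add_left mP mQ (mP'.add mQ')
  rw [covariance_add_right mP mP' mQ', covariance_add_right mQ mP' mQ', hi1,
    covariance_mulVec_of_hasLaw hC hV, covariance_comm (fun ω => (Q *ᵥ _) i),
    hi2, covariance_mulVec_of_hasLaw hC' hW, add_zero, zero_add] at h
  exact h

end Gaussian

/-! ### The inverse regression inside the forward model, and the central limit theorem for its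
score. -/

section Model

variable {L D : ℕ} {Ω : Type*} [MeasurableSpace Ω] {μ : Measure Ω}
  {Γ : Matrix (Fin L) (Fin L) ℝ} {S : Matrix (Fin D) (Fin D) ℝ} {A : Matrix (Fin D) (Fin L) ℝ}
  {X : ℕ → Ω → EuclideanSpace ℝ (Fin D)} {Y : ℕ → Ω → EuclideanSpace ℝ (Fin L)}

/-- The residual `x - A y` of the inverse regression. -/
def resid (A : Matrix (Fin D) (Fin L) ℝ) (x : EuclideanSpace ℝ (Fin D))
    (y : EuclideanSpace ℝ (Fin L)) : Fin D → ℝ :=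
  x.ofLp - A *ᵥ y.ofLp

/-- The noise `y - G x` of the forward regression. -/
def noise (G : Matrix (Fin L) (Fin D) ℝ) (x : EuclideanSpace ℝ (Fin D))
    (y : EuclideanSpace ℝ (Fin L)) : EuclideanSpace ℝ (Fin L) :=
  y - WithLp.toLp 2 (G *ᵥ x.ofLp)

theorem ofLp_eq_mulVec_add_noise (G : Matrix (Fin L) (Fin D) ℝ) (x : EuclideanSpace ℝ (Fin D))
    (y : EuclideanSpace ℝ (Fin L)) (a : Fin L) :
    y a = (G *ᵥ x.ofLp) a + ((1 : Matrix (Fin L) (Fin L) ℝ) *ᵥ (noise G x y).ofLp) a := by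
  simp [noise]

/-- Together with the same decomposition of `y`, this reduces all moments to those of the
independent pair formed by `X` and the noise. -/
theorem resid_eq_mulVec_add_noise (A : Matrix (Fin D) (Fin L) ℝ) (G : Matrix (Fin L) (Fin D) ℝ)
    (x : EuclideanSpace ℝ (Fin D)) (y : EuclideanSpace ℝ (Fin L)) (d : Fin D) :
    resid A x y d = ((1 - A * G) *ᵥ x.ofLp) d + ((-A) *ᵥ (noise G x y).ofLp) d := by
  simp only [resid, noise, Matrix.sub_mulVec, Matrix.one_mulVec, Matrix.neg_mulVec, Pi.sub_apply,
    Pi.neg_apply, WithLp.ofLp_sub, Matrix.mulVec_sub, Matrix.mulVec_mulVec, Matrix.neg_mul]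
  ring

theorem fun_Y_eq {Ω' : Type*} (G : Matrix (Fin L) (Fin D) ℝ) (x : Ω' → EuclideanSpace ℝ (Fin D))
    (y : Ω' → EuclideanSpace ℝ (Fin L)) (a : Fin L) :
    (fun ω => y ω a) = fun ω => (G *ᵥ (x ω).ofLp) a
      + ((1 : Matrix (Fin L) (Fin L) ℝ) *ᵥ (noise G (x ω) (y ω)).ofLp) a :=
  funext fun _ => ofLp_eq_mulVec_add_noise G _ _ a

theorem fun_resid_eq {Ω' : Type*} (A : Matrix (Fin D) (Fin L) ℝ) (G : Matrix (Fin L) (Fin D) ℝ)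
    (x : Ω' → EuclideanSpace ℝ (Fin D)) (y : Ω' → EuclideanSpace ℝ (Fin L)) (d : Fin D) :
    (fun ω => resid A (x ω) (y ω) d) = fun ω => ((1 - A * G) *ᵥ (x ω).ofLp) d
      + ((-A) *ᵥ (noise G (x ω) (y ω)).ofLp) d :=
  funext fun _ => resid_eq_mulVec_add_noise A G _ _ d

theorem IsForwardModel.hasLaw_noise {Γs : Matrix (Fin D) (Fin D) ℝ}
    {G : Matrix (Fin L) (Fin D) ℝ} {Ss : Matrix (Fin L) (Fin L) ℝ}
    (hm : IsForwardModel μ X Y Γs G Ss) (i : ℕ) :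
    HasLaw (fun ω => noise G (X i ω) (Y i ω)) (multivariateGaussian 0 Ss) μ :=
  hm.law_noise i

/-- The pair is a fixed measurable image of `X` and the noise, whose joint law is the product of two
laws not depending on `i`. -/
theorem IsForwardModel.identDistrib_pair {Γs : Matrix (Fin D) (Fin D) ℝ}
    {G : Matrix (Fin L) (Fin D) ℝ} {Ss : Matrix (Fin L) (Fin L) ℝ} [IsProbabilityMeasure μ]
    (hm : IsForwardModel μ X Y Γs G Ss) (i : ℕ) :
    IdentDistrib (fun ω => (X i ω, Y i ω)) (fun ω => (X 0 ω, Y 0 ω)) μ μ := by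
  have hX : IdentDistrib (X i) (X 0) μ μ :=
    ⟨(hm.law_X i).aemeasurable, (hm.law_X 0).aemeasurable,
      (hm.law_X i).map_eq.trans (hm.law_X 0).map_eq.symm⟩
  have hε : IdentDistrib (fun ω => noise G (X i ω) (Y i ω)) (fun ω => noise G (X 0 ω) (Y 0 ω)) μ μ :=
    ⟨(hm.law_noise i).aemeasurable, (hm.law_noise 0).aemeasurable,
      (hm.law_noise i).map_eq.trans (hm.law_noise 0).map_eq.symm⟩
  have h := (hX.prodMk hε (hm.indep_noise i) (hm.indep_noise 0)).comp
    (u := fun p => (p.1, p.2 + WithLp.toLp 2 (G *ᵥ p.1.ofLp))) (by fun_prop)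
  simpa [Function.comp_def, noise] using h

theorem IsForwardModel.hasGaussianLaw {Γs : Matrix (Fin D) (Fin D) ℝ}
    {G : Matrix (Fin L) (Fin D) ℝ} {Ss : Matrix (Fin L) (Fin L) ℝ}
    (hm : IsForwardModel μ X Y Γs G Ss) (A : Matrix (Fin D) (Fin L) ℝ) (i : ℕ) :
    HasGaussianLaw (fun ω => (fun d => resid A (X i ω) (Y i ω) d, fun a => Y i ω a)) μ := by
  have h := IndepFun.hasGaussianLaw (hm.law_X i).hasGaussianLaw (hm.law_noise i).hasGaussianLaw
    (hm.indep_noise i)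
  let φ : EuclideanSpace ℝ (Fin D) × EuclideanSpace ℝ (Fin L) →ₗ[ℝ]
      (Fin D → ℝ) × (Fin L → ℝ) :=
    { toFun := fun p => ((1 - A * G) *ᵥ p.1.ofLp + (-A) *ᵥ p.2.ofLp, G *ᵥ p.1.ofLp + p.2.ofLp)
      map_add' := fun p q => by
        ext <;> simp [Matrix.mulVec_add] <;> ring
      map_smul' := fun c p => by
        ext <;> simp [Matrix.mulVec_smul] }
  have e : (fun ω => (fun d => resid A (X i ω) (Y i ω) d, fun a => Y i ω a))
      = fun ω => φ.toContinuousLinearMap (X i ω, noise G (X i ω) (Y i ω)) := by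
    funext ω
    refine Prod.ext (funext fun d => resid_eq_mulVec_add_noise A G _ _ d) (funext fun a => ?_)
    refine (ofLp_eq_mulVec_add_noise G (X i ω) (Y i ω) a).trans ?_
    rw [Matrix.one_mulVec]
    rfl
  rw [e]
  exact h.map_fun φ.toContinuousLinearMap

theorem IsForwardModel.memLp_Y {Γs : Matrix (Fin D) (Fin D) ℝ}
    {G : Matrix (Fin L) (Fin D) ℝ} {Ss : Matrix (Fin L) (Fin L) ℝ}
    (hm : IsForwardModel μ X Y Γs G Ss) (i : ℕ) (a : Fin L) : MemLp (fun ω => Y i ω a) 2 μ :=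
  -- The residual component is discarded, so any matrix would do in place of `0`.
  ((hm.hasGaussianLaw 0 i).snd.eval a).memLp_two

theorem IsForwardModel.memLp_resid {Γs : Matrix (Fin D) (Fin D) ℝ}
    {G : Matrix (Fin L) (Fin D) ℝ} {Ss : Matrix (Fin L) (Fin L) ℝ}
    (hm : IsForwardModel μ X Y Γs G Ss) (i : ℕ) (d : Fin D) :
    MemLp (fun ω => resid A (X i ω) (Y i ω) d) 2 μ :=
  ((hm.hasGaussianLaw A i).fst.eval d).memLp_two

variable [IsProbabilityMeasure μ]

/-- The population normal equation: `Cov(X, Y) = A Γ` and `Var Y = Γ`. -/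
theorem covariance_resid_Y (hΓ : Γ.PosDef) (hS : S.PosDef)
    (hm : IsForwardModel μ X Y (gammaStar Γ S A) (g Γ S A) (sigmaStar Γ S A)) (i : ℕ)
    (d : Fin D) (a : Fin L) :
    cov[fun ω => resid A (X i ω) (Y i ω) d, fun ω => Y i ω a; μ] = 0 := by
  have h := covariance_mulVec_add_of_indepFun (posDef_gammaStar hΓ hS A).posSemidef
    (posDef_sigmaStar hΓ hS A).posSemidef (hm.law_X i) (hm.law_noise i) (hm.indep_noise i)
    (1 - A * g Γ S A) (-A) (g Γ S A) 1 d a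
  rw [fun_resid_eq A (g Γ S A), fun_Y_eq (g Γ S A) (X i) (Y i)]
  refine h.trans ?_
  have hg : gammaStar Γ S A * (g Γ S A)ᵀ = A * Γ := by
    rw [← transpose_eq_of_posDef (posDef_gammaStar hΓ hS A), ← Matrix.transpose_mul,
      g_mul_gammaStar hΓ hS, Matrix.transpose_mul, Matrix.transpose_transpose,
      transpose_eq_of_posDef hΓ]
  have : (1 - A * g Γ S A) * gammaStar Γ S A * (g Γ S A)ᵀ
      + -A * sigmaStar Γ S A * (1 : Matrix (Fin L) (Fin L) ℝ)ᵀ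
      = A * Γ - A * (g Γ S A * gammaStar Γ S A * (g Γ S A)ᵀ + sigmaStar Γ S A) := by
    rw [Matrix.mul_assoc, hg, Matrix.mul_assoc (g Γ S A), hg, Matrix.transpose_one, Matrix.mul_one,
      Matrix.sub_mul, Matrix.one_mul, Matrix.mul_add, Matrix.neg_mul]
    simp only [Matrix.mul_assoc]
    abel
  rw [this, g_mul_gammaStar_mul_g_transpose_add hΓ hS, sub_self, Matrix.zero_apply]

theorem covariance_Y (hΓ : Γ.PosDef) (hS : S.PosDef)
    (hm : IsForwardModel μ X Y (gammaStar Γ S A) (g Γ S A) (sigmaStar Γ S A)) (i : ℕ)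
    (a b : Fin L) : cov[fun ω => Y i ω a, fun ω => Y i ω b; μ] = Γ a b := by
  have h := covariance_mulVec_add_of_indepFun (posDef_gammaStar hΓ hS A).posSemidef
    (posDef_sigmaStar hΓ hS A).posSemidef (hm.law_X i) (hm.law_noise i) (hm.indep_noise i)
    (g Γ S A) 1 (g Γ S A) 1 a b
  rw [fun_Y_eq (g Γ S A) (X i) (Y i) a, fun_Y_eq (g Γ S A) (X i) (Y i) b]
  refine h.trans ?_
  rw [Matrix.one_mul, Matrix.transpose_one, Matrix.mul_one,
    g_mul_gammaStar_mul_g_transpose_add hΓ hS]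

theorem covariance_resid (hΓ : Γ.PosDef) (hS : S.PosDef)
    (hm : IsForwardModel μ X Y (gammaStar Γ S A) (g Γ S A) (sigmaStar Γ S A)) (i : ℕ)
    (d e : Fin D) :
    cov[fun ω => resid A (X i ω) (Y i ω) d, fun ω => resid A (X i ω) (Y i ω) e; μ] = S d e := by
  have h := covariance_mulVec_add_of_indepFun (posDef_gammaStar hΓ hS A).posSemidef
    (posDef_sigmaStar hΓ hS A).posSemidef (hm.law_X i) (hm.law_noise i) (hm.indep_noise i)
    (1 - A * g Γ S A) (-A) (1 - A * g Γ S A) (-A) d e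
  rw [fun_resid_eq A (g Γ S A), fun_resid_eq A (g Γ S A)]
  refine h.trans ?_
  have hg : gammaStar Γ S A * (g Γ S A)ᵀ = A * Γ := by
    rw [← transpose_eq_of_posDef (posDef_gammaStar hΓ hS A), ← Matrix.transpose_mul,
      g_mul_gammaStar hΓ hS, Matrix.transpose_mul, Matrix.transpose_transpose,
      transpose_eq_of_posDef hΓ]
  have : (1 - A * g Γ S A) * gammaStar Γ S A * (1 - A * g Γ S A)ᵀ
      + -A * sigmaStar Γ S A * (-A)ᵀ = gammaStar Γ S A - A * (g Γ S A * gammaStar Γ S A)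
        - gammaStar Γ S A * (g Γ S A)ᵀ * Aᵀ
        + A * (g Γ S A * gammaStar Γ S A * (g Γ S A)ᵀ + sigmaStar Γ S A) * Aᵀ := by
    simp only [Matrix.transpose_sub, Matrix.transpose_one, Matrix.transpose_mul,
      Matrix.transpose_neg, Matrix.neg_mul, Matrix.mul_neg, neg_neg, Matrix.mul_sub,
      Matrix.sub_mul, Matrix.one_mul, Matrix.mul_one, Matrix.mul_add, Matrix.add_mul,
      Matrix.mul_assoc]
    abel
  rw [this, g_mul_gammaStar_mul_g_transpose_add hΓ hS, g_mul_gammaStar hΓ hS, hg, gammaStar,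
    ← Matrix.mul_assoc]
  simp

theorem IsForwardModel.integral_Y {Γs : Matrix (Fin D) (Fin D) ℝ}
    {G : Matrix (Fin L) (Fin D) ℝ} {Ss : Matrix (Fin L) (Fin L) ℝ}
    (hm : IsForwardModel μ X Y Γs G Ss) (i : ℕ) (a : Fin L) : ∫ ω, Y i ω a ∂μ = 0 := by
  rw [fun_Y_eq G (X i) (Y i)]
  rw [integral_add ((memLp_mulVec_of_hasLaw (hm.law_X i) _ _).integrable (by norm_num))
    ((memLp_mulVec_of_hasLaw (hm.hasLaw_noise i) _ _).integrable (by norm_num)),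
    integral_mulVec_of_hasLaw (hm.law_X i), zero_add]
  exact integral_mulVec_of_hasLaw (hm.hasLaw_noise i) _ _

theorem IsForwardModel.integral_resid {Γs : Matrix (Fin D) (Fin D) ℝ}
    {G : Matrix (Fin L) (Fin D) ℝ} {Ss : Matrix (Fin L) (Fin L) ℝ}
    (hm : IsForwardModel μ X Y Γs G Ss) (i : ℕ) (d : Fin D) :
    ∫ ω, resid A (X i ω) (Y i ω) d ∂μ = 0 := by
  rw [fun_resid_eq A G]
  rw [integral_add ((memLp_mulVec_of_hasLaw (hm.law_X i) _ _).integrable (by norm_num))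
    ((memLp_mulVec_of_hasLaw (hm.hasLaw_noise i) _ _).integrable (by norm_num)),
    integral_mulVec_of_hasLaw (hm.law_X i), zero_add]
  exact integral_mulVec_of_hasLaw (hm.hasLaw_noise i) _ _

theorem integral_Y_mul_Y (hΓ : Γ.PosDef) (hS : S.PosDef)
    (hm : IsForwardModel μ X Y (gammaStar Γ S A) (g Γ S A) (sigmaStar Γ S A)) (i : ℕ)
    (a b : Fin L) : ∫ ω, Y i ω a * Y i ω b ∂μ = Γ a b := by
  have h := covariance_eq_sub (hm.memLp_Y i a) (hm.memLp_Y i b)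
  rw [covariance_Y hΓ hS hm, hm.integral_Y, zero_mul, sub_zero] at h
  exact h.symm

theorem integral_resid_mul_resid (hΓ : Γ.PosDef) (hS : S.PosDef)
    (hm : IsForwardModel μ X Y (gammaStar Γ S A) (g Γ S A) (sigmaStar Γ S A)) (i : ℕ)
    (d e : Fin D) :
    ∫ ω, resid A (X i ω) (Y i ω) d * resid A (X i ω) (Y i ω) e ∂μ = S d e := by
  have h := covariance_eq_sub (hm.memLp_resid (A := A) i d) (hm.memLp_resid (A := A) i e)
  rw [covariance_resid hΓ hS hm, hm.integral_resid, zero_mul, sub_zero] at h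
  exact h.symm

theorem indepFun_resid_Y (hΓ : Γ.PosDef) (hS : S.PosDef)
    (hm : IsForwardModel μ X Y (gammaStar Γ S A) (g Γ S A) (sigmaStar Γ S A)) (i : ℕ) :
    IndepFun (fun ω d => resid A (X i ω) (Y i ω) d) (fun ω a => Y i ω a) μ :=
  (hm.hasGaussianLaw A i).indepFun_of_covariance_eval (covariance_resid_Y hΓ hS hm i)

/-- The score vector `vec ((x - A y) yᵀ)`. -/
def score (A : Matrix (Fin D) (Fin L) ℝ) (p : EuclideanSpace ℝ (Fin D) × EuclideanSpace ℝ (Fin L)) :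
    EuclideanSpace ℝ (Fin L × Fin D) :=
  evec (Matrix.vecMulVec (resid A p.1 p.2) p.2.ofLp)

theorem score_apply (A : Matrix (Fin D) (Fin L) ℝ)
    (p : EuclideanSpace ℝ (Fin D) × EuclideanSpace ℝ (Fin L)) (q : Fin L × Fin D) :
    score A p q = resid A p.1 p.2 q.2 * p.2 q.1 := rfl

theorem measurable_score (A : Matrix (Fin D) (Fin L) ℝ) : Measurable (score A) := by
  refine Continuous.measurable (continuous_evec.comp (Continuous.matrix_vecMulVec ?_ ?_))
  · unfold resid; fun_prop
  · fun_prop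

/-- The product regroups into a product of residuals times a product of entries of `Y`. These are
independent, so second moments suffice for integrability and the expectation factors. -/
theorem integrable_score_mul_score (hΓ : Γ.PosDef) (hS : S.PosDef)
    (hm : IsForwardModel μ X Y (gammaStar Γ S A) (g Γ S A) (sigmaStar Γ S A))
    (i : ℕ) (p q : Fin L × Fin D) :
    Integrable (fun ω => score A (X i ω, Y i ω) p * score A (X i ω, Y i ω) q) μ ∧
    ∫ ω, score A (X i ω, Y i ω) p * score A (X i ω, Y i ω) q ∂μ = (Γ ⊗ₖ S) p q := by
  have hU : Integrable (fun ω => resid A (X i ω) (Y i ω) p.2 * resid A (X i ω) (Y i ω) q.2) μ :=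
    (hm.memLp_resid i p.2).integrable_mul (hm.memLp_resid i q.2)
  have hY : Integrable (fun ω => Y i ω p.1 * Y i ω q.1) μ :=
    (hm.memLp_Y i p.1).integrable_mul (hm.memLp_Y i q.1)
  have hind : IndepFun (fun ω => resid A (X i ω) (Y i ω) p.2 * resid A (X i ω) (Y i ω) q.2)
      (fun ω => Y i ω p.1 * Y i ω q.1) μ :=
    (indepFun_resid_Y hΓ hS hm i).comp (φ := fun u : Fin D → ℝ => u p.2 * u q.2)
      (ψ := fun y : Fin L → ℝ => y p.1 * y q.1) (by fun_prop) (by fun_prop)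
  have e : (fun ω => score A (X i ω, Y i ω) p * score A (X i ω, Y i ω) q)
      = fun ω => (resid A (X i ω) (Y i ω) p.2 * resid A (X i ω) (Y i ω) q.2)
        * (Y i ω p.1 * Y i ω q.1) := by
    ext ω; simp only [score_apply]; ring
  rw [e]
  refine ⟨hind.integrable_mul hU hY, ?_⟩
  rw [hind.integral_fun_mul_eq_mul_integral hU.aestronglyMeasurable hY.aestronglyMeasurable,
    integral_resid_mul_resid hΓ hS hm, integral_Y_mul_Y hΓ hS hm, mul_comm]
  rfl

theorem memLp_score (hΓ : Γ.PosDef) (hS : S.PosDef)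
    (hm : IsForwardModel μ X Y (gammaStar Γ S A) (g Γ S A) (sigmaStar Γ S A)) (i : ℕ) :
    MemLp (fun ω => score A (X i ω, Y i ω)) 2 μ := by
  refine MemLp.of_eval_piLp fun p => ?_
  refine (memLp_two_iff_integrable_sq ?_).2 ?_
  · exact ((hm.memLp_resid i p.2).aestronglyMeasurable.mul (hm.memLp_Y i p.1).aestronglyMeasurable)
  · simpa only [sq] using (integrable_score_mul_score hΓ hS hm i p p).1

theorem integral_score (hΓ : Γ.PosDef) (hS : S.PosDef)
    (hm : IsForwardModel μ X Y (gammaStar Γ S A) (g Γ S A) (sigmaStar Γ S A)) (i : ℕ)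
    (p : Fin L × Fin D) : ∫ ω, score A (X i ω, Y i ω) p ∂μ = 0 := by
  have hind : IndepFun (fun ω => resid A (X i ω) (Y i ω) p.2) (fun ω => Y i ω p.1) μ :=
    (indepFun_resid_Y hΓ hS hm i).comp (φ := fun u : Fin D → ℝ => u p.2) (ψ := fun y : Fin L → ℝ => y p.1)
      (by fun_prop) (by fun_prop)
  simp only [score_apply]
  rw [hind.integral_fun_mul_eq_mul_integral (hm.memLp_resid i p.2).aestronglyMeasurable
    (hm.memLp_Y i p.1).aestronglyMeasurable, hm.integral_Y, mul_zero]

/-- Central limit theorem for the score. -/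
theorem tendstoInDistribution_sum_score (hΓ : Γ.PosDef) (hS : S.PosDef)
    (hm : IsForwardModel μ X Y (gammaStar Γ S A) (g Γ S A) (sigmaStar Γ S A)) :
    TendstoInDistribution
      (fun (N : ℕ) ω => (√(N : ℝ))⁻¹ • ∑ k ∈ Finset.range N, score A (X k ω, Y k ω))
      atTop id (fun _ => μ) (multivariateGaussian 0 (Γ ⊗ₖ S)) := by
  have hL2 := memLp_score hΓ hS hm 0
  have hint (p : Fin L × Fin D) : Integrable (fun ω => score A (X 0 ω, Y 0 ω) p) μ :=
    (hL2.eval_piLp p).integrable (by norm_num)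
  refine tendstoInDistribution_inv_sqrt_smul_sum (ξ := fun k ω => score A (X k ω, Y k ω))
    (hΓ.kronecker hS).posSemidef
    (hm.indep_pairs.comp (fun _ => score A) fun _ => measurable_score A)
    (fun i => (hm.identDistrib_pair i).comp (measurable_score A)) hL2 (fun t => ?_) fun t => ?_
  · simp only [PiLp.inner_apply, RCLike.inner_apply, conj_trivial]
    rw [integral_finsetSum _ fun p _ => (hint p).const_mul _]
    simp [integral_const_mul, integral_score hΓ hS hm]
  · have e (ω : Ω) : inner ℝ (score A (X 0 ω, Y 0 ω)) t ^ 2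
        = ∑ p, ∑ q, t p * t q * (score A (X 0 ω, Y 0 ω) p * score A (X 0 ω, Y 0 ω) q) := by
      simp only [PiLp.inner_apply, RCLike.inner_apply, conj_trivial]
      rw [sq, Finset.sum_mul_sum]
      refine Finset.sum_congr rfl fun p _ => Finset.sum_congr rfl fun q _ => by ring
    simp_rw [e]
    rw [integral_finsetSum _ fun p _ => integrable_finsetSum _ fun q _ =>
      (integrable_score_mul_score hΓ hS hm 0 p q).1.const_mul _]
    simp only [dotProduct, Matrix.mulVec, Finset.mul_sum]
    refine Finset.sum_congr rfl fun p _ => ?_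
    rw [integral_finsetSum _ fun q _ => (integrable_score_mul_score hΓ hS hm 0 p q).1.const_mul _]
    refine Finset.sum_congr rfl fun q _ => ?_
    rw [integral_const_mul, (integrable_score_mul_score hΓ hS hm 0 p q).2]
    ring

end Model

/-! ### Measurability and convergence of random matrices, handled entrywise. -/

section Measurability

variable {Ω : Type*} [MeasurableSpace Ω] {μ : Measure Ω} {ι κ : Type*} [Fintype ι]

theorem aemeasurable_of_continuous_entries [Finite κ] {F : Type*} [TopologicalSpace F]
    [MeasurableSpace F] [BorelSpace F] {f : Matrix ι κ ℝ → F} (hf : Continuous f)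
    {M : Ω → Matrix ι κ ℝ} (hM : ∀ i j, AEMeasurable (fun ω => M ω i j) μ) :
    AEMeasurable (fun ω => f (M ω)) μ := by
  have hf' : Continuous fun m : ι → κ → ℝ => f (Matrix.of m) := hf
  exact hf'.measurable.comp_aemeasurable
    (aemeasurable_pi_lambda _ fun i => aemeasurable_pi_lambda _ fun j => hM i j)

theorem aemeasurable_matrix_mul {l : Type*} {M : Ω → Matrix l ι ℝ} {N : Ω → Matrix ι κ ℝ}
    (hM : ∀ i j, AEMeasurable (fun ω => M ω i j) μ) (hN : ∀ i j, AEMeasurable (fun ω => N ω i j) μ)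
    (i : l) (j : κ) : AEMeasurable (fun ω => (M ω * N ω) i j) μ := by
  simp only [Matrix.mul_apply]
  exact Finset.aemeasurable_fun_sum _ fun k _ => (hM i k).mul (hN k j)

/-- The adjugate formula also covers singular matrices, whose inverse is 0 here. -/
theorem aemeasurable_matrix_inv [DecidableEq ι] {M : Ω → Matrix ι ι ℝ}
    (hM : ∀ i j, AEMeasurable (fun ω => M ω i j) μ) (i j : ι) :
    AEMeasurable (fun ω => (M ω)⁻¹ i j) μ := by
  have hdet := aemeasurable_of_continuous_entries (f := fun M : Matrix ι ι ℝ => M.det)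
    (by fun_prop) hM
  have hadj := aemeasurable_of_continuous_entries (f := fun M : Matrix ι ι ℝ => M.adjugate i j)
    (continuous_id.matrix_adjugate.matrix_elem i j) hM
  simp only [Matrix.inv_def, Matrix.smul_apply, Ring.inverse_eq_inv', smul_eq_mul]
  exact hdet.inv.mul hadj

theorem tendstoInMeasure_entries [IsFiniteMeasure μ] [Fintype κ] {M : ℕ → Ω → Matrix ι κ ℝ}
    {C : Matrix ι κ ℝ} (hM : ∀ N i j, AEMeasurable (fun ω => M N ω i j) μ)
    (h : ∀ᵐ ω ∂μ, Tendsto (fun N => M N ω) atTop (𝓝 C)) :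
    TendstoInMeasure μ (fun N ω (i : ι) (j : κ) => M N ω i j) atTop (fun _ i j => C i j) :=
  tendstoInMeasure_of_tendsto_ae
    (fun N => (aemeasurable_pi_lambda _ fun i =>
      aemeasurable_pi_lambda _ fun j => hM N i j).aestronglyMeasurable) h

theorem tendsto_matrix_inv [DecidableEq ι] {C : Matrix ι ι ℝ} (hC : C.det ≠ 0) {α : Type*}
    {l : Filter α} {M : α → Matrix ι ι ℝ} (hM : Tendsto M l (𝓝 C)) :
    Tendsto (fun a => (M a)⁻¹) l (𝓝 C⁻¹) := by
  refine (continuousAt_matrix_inv C ?_).tendsto.comp hM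
  simpa [Ring.inverse_eq_inv'] using continuousAt_inv₀ hC

end Measurability

/-! ### The least squares estimator and its strong consistency. -/

section Model

variable {L D : ℕ} {Ω : Type*} [MeasurableSpace Ω] {μ : Measure Ω}
  {Γ : Matrix (Fin L) (Fin L) ℝ} {S : Matrix (Fin D) (Fin D) ℝ} {A : Matrix (Fin D) (Fin L) ℝ}
  {X : ℕ → Ω → EuclideanSpace ℝ (Fin D)} {Y : ℕ → Ω → EuclideanSpace ℝ (Fin L)}

/-- The empirical second moment matrix `Y Yᵀ / N`. -/
def gram {Ω : Type*} (Y : ℕ → Ω → EuclideanSpace ℝ (Fin L)) (N : ℕ) (ω : Ω) :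
    Matrix (Fin L) (Fin L) ℝ :=
  (N : ℝ)⁻¹ • (dataMatrix Y N ω * (dataMatrix Y N ω)ᵀ)

/-- The unnormalized score `∑ (Xₖ - A Yₖ) Yₖᵀ`. -/
def scoreSum {Ω : Type*} (A : Matrix (Fin D) (Fin L) ℝ) (X : ℕ → Ω → EuclideanSpace ℝ (Fin D))
    (Y : ℕ → Ω → EuclideanSpace ℝ (Fin L)) (N : ℕ) (ω : Ω) : Matrix (Fin D) (Fin L) ℝ :=
  unvec (∑ k ∈ Finset.range N, score A (X k ω, Y k ω))

theorem gram_apply {Ω : Type*} (Y : ℕ → Ω → EuclideanSpace ℝ (Fin L)) (N : ℕ) (ω : Ω)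
    (a b : Fin L) :
    gram Y N ω a b = (N : ℝ)⁻¹ * ∑ k ∈ Finset.range N, Y k ω a * Y k ω b := by
  rw [gram, Matrix.smul_apply, Matrix.mul_apply, smul_eq_mul, Finset.sum_range]
  rfl

theorem scoreSum_apply {Ω : Type*} (A : Matrix (Fin D) (Fin L) ℝ)
    (X : ℕ → Ω → EuclideanSpace ℝ (Fin D)) (Y : ℕ → Ω → EuclideanSpace ℝ (Fin L)) (N : ℕ) (ω : Ω)
    (d : Fin D) (a : Fin L) :
    scoreSum A X Y N ω d a = ∑ k ∈ Finset.range N, score A (X k ω, Y k ω) (a, d) := by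
  simp [scoreSum, unvec]

theorem scoreSum_eq {Ω : Type*} (A : Matrix (Fin D) (Fin L) ℝ)
    (X : ℕ → Ω → EuclideanSpace ℝ (Fin D)) (Y : ℕ → Ω → EuclideanSpace ℝ (Fin L)) (N : ℕ) (ω : Ω) :
    scoreSum A X Y N ω
      = (dataMatrix X N ω - A * dataMatrix Y N ω) * (dataMatrix Y N ω)ᵀ := by
  ext d a
  rw [scoreSum_apply, Finset.sum_range, Matrix.mul_apply]
  rfl

theorem Ahat_sub {Ω : Type*} (A : Matrix (Fin D) (Fin L) ℝ)
    (X : ℕ → Ω → EuclideanSpace ℝ (Fin D)) (Y : ℕ → Ω → EuclideanSpace ℝ (Fin L)) {N : ℕ} {ω : Ω}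
    (hdet : (gram Y N ω).det ≠ 0) :
    Ahat X Y N ω - A = (N : ℝ)⁻¹ • scoreSum A X Y N ω * (gram Y N ω)⁻¹ := by
  set P := dataMatrix X N ω
  set Q := dataMatrix Y N ω
  have hR : IsUnit (Q * Qᵀ).det := by
    rw [gram, Matrix.det_smul] at hdet
    exact (right_ne_zero_of_mul hdet).isUnit
  have h : (Ahat X Y N ω - A) * (Q * Qᵀ) = scoreSum A X Y N ω := by
    rw [scoreSum_eq, Ahat, Matrix.sub_mul, Matrix.mul_assoc _ _ (Q * Qᵀ),
      Matrix.nonsing_inv_mul _ hR, Matrix.mul_one, Matrix.sub_mul, Matrix.mul_assoc A]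
  rw [← h, ← Matrix.mul_smul]
  exact (Matrix.mul_nonsing_inv_cancel_right _ _ hdet.isUnit).symm

theorem IsForwardModel.aemeasurable_X {Γs : Matrix (Fin D) (Fin D) ℝ}
    {G : Matrix (Fin L) (Fin D) ℝ} {Ss : Matrix (Fin L) (Fin L) ℝ}
    (hm : IsForwardModel μ X Y Γs G Ss) (i : ℕ) (d : Fin D) : AEMeasurable (fun ω => X i ω d) μ :=
  Measurable.comp_aemeasurable (g := fun x : EuclideanSpace ℝ (Fin D) => x d) (by fun_prop)
    (hm.law_X i).aemeasurable

theorem IsForwardModel.aemeasurable_gram {Γs : Matrix (Fin D) (Fin D) ℝ}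
    {G : Matrix (Fin L) (Fin D) ℝ} {Ss : Matrix (Fin L) (Fin L) ℝ}
    (hm : IsForwardModel μ X Y Γs G Ss) (N : ℕ) (a b : Fin L) :
    AEMeasurable (fun ω => gram Y N ω a b) μ := by
  simp_rw [gram_apply]
  exact (Finset.aemeasurable_fun_sum _ fun k _ =>
    (hm.memLp_Y k a).aestronglyMeasurable.aemeasurable.mul (hm.memLp_Y k b).aestronglyMeasurable.aemeasurable).const_mul _

theorem IsForwardModel.aemeasurable_Ahat {Γs : Matrix (Fin D) (Fin D) ℝ}
    {G : Matrix (Fin L) (Fin D) ℝ} {Ss : Matrix (Fin L) (Fin L) ℝ}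
    (hm : IsForwardModel μ X Y Γs G Ss) (N : ℕ) (d : Fin D) (a : Fin L) :
    AEMeasurable (fun ω => Ahat X Y N ω d a) μ := by
  have hY (a : Fin L) (k : Fin N) : AEMeasurable (fun ω => dataMatrix Y N ω a k) μ :=
    (hm.memLp_Y k a).aestronglyMeasurable.aemeasurable
  have hX (d : Fin D) (k : Fin N) : AEMeasurable (fun ω => dataMatrix X N ω d k) μ :=
    hm.aemeasurable_X k d
  have hYt (k : Fin N) (a : Fin L) : AEMeasurable (fun ω => (dataMatrix Y N ω)ᵀ k a) μ := hY a k
  exact aemeasurable_matrix_mul (aemeasurable_matrix_mul hX hYt)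
    (aemeasurable_matrix_inv (aemeasurable_matrix_mul hY hYt)) d a

variable [IsProbabilityMeasure μ]

theorem IsForwardModel.ae_tendsto_average {Γs : Matrix (Fin D) (Fin D) ℝ}
    {G : Matrix (Fin L) (Fin D) ℝ} {Ss : Matrix (Fin L) (Fin L) ℝ}
    (hm : IsForwardModel μ X Y Γs G Ss)
    {f : EuclideanSpace ℝ (Fin D) × EuclideanSpace ℝ (Fin L) → ℝ} (hf : Measurable f)
    (hint : Integrable (fun ω => f (X 0 ω, Y 0 ω)) μ) :
    ∀ᵐ ω ∂μ, Tendsto (fun N : ℕ => (N : ℝ)⁻¹ * ∑ k ∈ Finset.range N, f (X k ω, Y k ω)) atTop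
      (𝓝 (∫ ω, f (X 0 ω, Y 0 ω) ∂μ)) :=
  strong_law_ae (fun k ω => f (X k ω, Y k ω)) hint
    (fun _ _ hij => (hm.indep_pairs.indepFun hij).comp hf hf)
    (fun i => (hm.identDistrib_pair i).comp hf)

theorem ae_tendsto_gram (hΓ : Γ.PosDef) (hS : S.PosDef)
    (hm : IsForwardModel μ X Y (gammaStar Γ S A) (g Γ S A) (sigmaStar Γ S A)) :
    ∀ᵐ ω ∂μ, Tendsto (fun N => gram Y N ω) atTop (𝓝 Γ) := by
  have h : ∀ᵐ ω ∂μ, ∀ a b, Tendsto (fun N => gram Y N ω a b) atTop (𝓝 (Γ a b)) := by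
    refine ae_all_iff.2 fun a => ae_all_iff.2 fun b => ?_
    simp_rw [gram_apply, ← integral_Y_mul_Y hΓ hS hm 0 a b]
    exact hm.ae_tendsto_average (f := fun p => p.2 a * p.2 b) (by fun_prop)
      ((hm.memLp_Y 0 a).integrable_mul (hm.memLp_Y 0 b))
  filter_upwards [h] with ω hω
  exact tendsto_pi_nhds.2 fun a => tendsto_pi_nhds.2 fun b => hω a b

theorem ae_tendsto_scoreSum (hΓ : Γ.PosDef) (hS : S.PosDef)
    (hm : IsForwardModel μ X Y (gammaStar Γ S A) (g Γ S A) (sigmaStar Γ S A)) :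
    ∀ᵐ ω ∂μ, Tendsto (fun N : ℕ => (N : ℝ)⁻¹ • scoreSum A X Y N ω) atTop (𝓝 0) := by
  have h : ∀ᵐ ω ∂μ, ∀ d a, Tendsto (fun N : ℕ => ((N : ℝ)⁻¹ • scoreSum A X Y N ω) d a) atTop
      (𝓝 0) := by
    refine ae_all_iff.2 fun d => ae_all_iff.2 fun a => ?_
    simp_rw [Matrix.smul_apply, scoreSum_apply, smul_eq_mul,
      ← integral_score hΓ hS hm 0 (a, d)]
    exact hm.ae_tendsto_average (f := fun p => score A p (a, d))
      (Measurable.comp (g := fun z : EuclideanSpace ℝ (Fin L × Fin D) => z (a, d)) (by fun_prop)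
        (measurable_score A))
      (((memLp_score hΓ hS hm 0).eval_piLp (a, d)).integrable (by norm_num))
  filter_upwards [h] with ω hω
  exact tendsto_pi_nhds.2 fun a => tendsto_pi_nhds.2 fun b => hω a b

/-- Ensures that the default value of a singular inverse plays no role in the limits. -/
theorem ae_eventually_det_gram_ne_zero (hΓ : Γ.PosDef) (hS : S.PosDef)
    (hm : IsForwardModel μ X Y (gammaStar Γ S A) (g Γ S A) (sigmaStar Γ S A)) :
    ∀ᵐ ω ∂μ, ∀ᶠ N in atTop, (gram Y N ω).det ≠ 0 := by
  filter_upwards [ae_tendsto_gram hΓ hS hm] with ω hω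
  have hc : Continuous fun M : Matrix (Fin L) (Fin L) ℝ => M.det := by fun_prop
  exact ((hc.tendsto Γ).comp hω).eventually_ne hΓ.det_pos.ne'

theorem ae_tendsto_Ahat (hΓ : Γ.PosDef) (hS : S.PosDef)
    (hm : IsForwardModel μ X Y (gammaStar Γ S A) (g Γ S A) (sigmaStar Γ S A)) :
    ∀ᵐ ω ∂μ, Tendsto (fun N => Ahat X Y N ω) atTop (𝓝 A) := by
  filter_upwards [ae_tendsto_gram hΓ hS hm, ae_tendsto_scoreSum hΓ hS hm,
    ae_eventually_det_gram_ne_zero hΓ hS hm] with ω h1 h2 h3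
  have hc : Continuous fun p : Matrix (Fin D) (Fin L) ℝ × Matrix (Fin L) (Fin L) ℝ =>
      p.1 * p.2 + A := by fun_prop
  have h4 := (hc.tendsto (0, Γ⁻¹)).comp
    (h2.prodMk_nhds (tendsto_matrix_inv hΓ.det_pos.ne' h1))
  simp only [Matrix.zero_mul, zero_add] at h4
  refine h4.congr' ?_
  filter_upwards [h3] with N hN
  simp [← Ahat_sub A X Y hN]

end Model

/-! ### The limit theorems. -/

section Limits

variable {L D : ℕ} {Ω : Type*} [MeasurableSpace Ω] {μ : Measure Ω}
  {Γ : Matrix (Fin L) (Fin L) ℝ} {S : Matrix (Fin D) (Fin D) ℝ} {A : Matrix (Fin D) (Fin L) ℝ}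
  {X : ℕ → Ω → EuclideanSpace ℝ (Fin D)} {Y : ℕ → Ω → EuclideanSpace ℝ (Fin L)}

theorem aemeasurable_Theta_Ahat (hΓ : Γ.PosDef) (hS : S.PosDef)
    (hm : IsForwardModel μ X Y (gammaStar Γ S A) (g Γ S A) (sigmaStar Γ S A)) (N : ℕ)
    (p q : Fin D × Fin L) : AEMeasurable (fun ω => Theta Γ S (Ahat X Y N ω) p q) μ :=
  aemeasurable_of_continuous_entries (f := fun B => Theta Γ S B p q)
    ((continuous_Theta hΓ hS).matrix_elem p q) (hm.aemeasurable_Ahat N)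

variable [IsProbabilityMeasure μ]

theorem tendstoInDistribution_Ahat (hΓ : Γ.PosDef) (hS : S.PosDef)
    (hm : IsForwardModel μ X Y (gammaStar Γ S A) (g Γ S A) (sigmaStar Γ S A)) :
    TendstoInDistribution
      (fun (N : ℕ) ω => √(N : ℝ) • (evec (Ahat X Y N ω) - evec A))
      atTop id (fun _ => μ) (multivariateGaussian 0 (Γ⁻¹ ⊗ₖ S)) := by
  have hinv : ∀ᵐ ω ∂μ, Tendsto (fun N => (gram Y N ω)⁻¹) atTop (𝓝 Γ⁻¹) := by
    filter_upwards [ae_tendsto_gram hΓ hS hm] with ω hω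
    exact tendsto_matrix_inv hΓ.det_pos.ne' hω
  have hinvm (N : ℕ) := aemeasurable_matrix_inv (hm.aemeasurable_gram N)
  have hf : Continuous fun p : EuclideanSpace ℝ (Fin L × Fin D) × (Fin L → Fin L → ℝ) =>
      evec (unvec p.1 * Matrix.of p.2) :=
    continuous_evec.comp ((continuous_unvec.comp continuous_fst).matrix_mul continuous_snd)
  have h1 := TendstoInDistribution.continuous_comp_prodMk_of_tendstoInMeasure_const hf
    (tendstoInDistribution_sum_score hΓ hS hm) (tendstoInMeasure_entries hinvm hinv)
    (fun N => aemeasurable_pi_lambda _ fun i => aemeasurable_pi_lambda _ fun j => hinvm N i j)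
  have hAm (N : ℕ) : AEMeasurable (fun ω => √(N : ℝ) • (evec (Ahat X Y N ω) - evec A)) μ :=
    aemeasurable_of_continuous_entries (f := fun B => √(N : ℝ) • (evec B - evec A))
      (by fun_prop) (hm.aemeasurable_Ahat N)
  -- The normalized error of `Ahat` agrees with the Slutsky sequence `h1` as soon as the Gram matrix
  -- is invertible, so almost surely their difference is eventually 0.
  have h2 := tendstoInDistribution_of_tendstoInMeasure_sub
    (fun (N : ℕ) ω => √(N : ℝ) • (evec (Ahat X Y N ω) - evec A)) _ h1 ?_ hAm
  · refine tendstoInDistribution_id_of_map_eq h2 ?_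
    have hΓΓ : Γ⁻¹ * Γ = 1 := Matrix.nonsing_inv_mul _ hΓ.det_pos.ne'.isUnit
    have hΓt : Γ⁻¹ᵀ = Γ⁻¹ := transpose_eq_of_posDef hΓ.inv
    -- Right multiplication by the symmetric `Γ⁻¹` acts on vectorizations as `Γ⁻¹ ⊗ 1`.
    have hcov : (Γ⁻¹ ⊗ₖ (1 : Matrix (Fin D) (Fin D) ℝ)) * (Γ ⊗ₖ S)
        * (Γ⁻¹ ⊗ₖ (1 : Matrix (Fin D) (Fin D) ℝ))ᵀ = Γ⁻¹ ⊗ₖ S := by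
      rw [← Matrix.kroneckerMap_transpose, ← Matrix.mul_kronecker_mul, ← Matrix.mul_kronecker_mul,
        hΓΓ, hΓt, Matrix.one_mul, Matrix.one_mul, Matrix.transpose_one, Matrix.mul_one]
    rw [← hcov, ← map_multivariateGaussian_mulVec (hΓ.kronecker hS).posSemidef]
    congr 1
    ext1 z
    refine congrArg (WithLp.toLp 2) ?_
    have := Matrix.kronecker_mulVec_vec (1 : Matrix (Fin D) (Fin D) ℝ) (unvec z) Γ⁻¹
    rw [Matrix.one_mul, hΓt] at this
    exact this.symm
  · refine tendstoInMeasure_of_tendsto_ae (fun N =>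
      ((hAm N).sub (h1.forall_aemeasurable N)).aestronglyMeasurable) ?_
    filter_upwards [ae_eventually_det_gram_ne_zero hΓ hS hm] with ω hω
    refine tendsto_const_nhds.congr' ?_
    filter_upwards [hω] with N hN
    have hsqrt : (√(N : ℝ))⁻¹ = √(N : ℝ) * (N : ℝ)⁻¹ := by
      rw [← div_eq_mul_inv, Real.sqrt_div_self]
    simp only [Pi.sub_apply, Pi.zero_apply]
    rw [eq_comm, sub_eq_zero, ← evec_sub, Ahat_sub A X Y hN, ← evec_smul, hsqrt, ← Matrix.smul_mul,
      smul_smul]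
    rfl

theorem gIncrement_smul (A B H : Matrix (Fin D) (Fin L) ℝ) (c : ℝ) :
    gIncrement Γ S A B (c • H) = c • gIncrement Γ S A B H := by
  simp only [gIncrement, Matrix.transpose_smul, Matrix.mul_smul, Matrix.smul_mul, smul_sub]

theorem tendstoInDistribution_g_Ahat (hΓ : Γ.PosDef) (hS : S.PosDef)
    (hm : IsForwardModel μ X Y (gammaStar Γ S A) (g Γ S A) (sigmaStar Γ S A)) :
    TendstoInDistribution
      (fun (N : ℕ) ω => √(N : ℝ) • (evec (g Γ S (Ahat X Y N ω)) - evec (g Γ S A)))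
      atTop id (fun _ => μ) (multivariateGaussian 0 (Theta Γ S A)) := by
  have hf : Continuous fun p : EuclideanSpace ℝ (Fin L × Fin D) × (Fin D → Fin L → ℝ) =>
      evec (gIncrement Γ S A (Matrix.of p.2) (unvec p.1)) :=
    continuous_evec.comp (continuous_gIncrement hΓ hS A continuous_snd
      (continuous_unvec.comp continuous_fst))
  have h1 := TendstoInDistribution.continuous_comp_prodMk_of_tendstoInMeasure_const hf
    (tendstoInDistribution_Ahat hΓ hS hm)
    (tendstoInMeasure_entries hm.aemeasurable_Ahat (ae_tendsto_Ahat hΓ hS hm))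
    (fun N => aemeasurable_pi_lambda _ fun i => aemeasurable_pi_lambda _ fun j =>
      hm.aemeasurable_Ahat N i j)
  -- An identity for every `N` and `ω`, since `g_sub_g` is exact and linear in the increment.
  have h2 : (fun (N : ℕ) ω => √(N : ℝ) • (evec (g Γ S (Ahat X Y N ω)) - evec (g Γ S A)))
      = fun (N : ℕ) ω => evec (gIncrement Γ S A (Matrix.of fun i j => Ahat X Y N ω i j)
        (unvec (√(N : ℝ) • (evec (Ahat X Y N ω) - evec A)))) := by
    ext1 N
    ext1 ω
    rw [← evec_sub, g_sub_g hΓ hS, ← evec_smul, ← gIncrement_smul]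
    rfl
  rw [h2]
  refine tendstoInDistribution_id_of_map_eq h1 ?_
  rw [← dgMatrix_mul_mul_transpose hΓ hS,
    ← map_multivariateGaussian_mulVec (hΓ.inv.kronecker hS).posSemidef]
  congr 1
  ext1 z
  -- At the limit `B = A`, `gIncrement` is `dgFormula` by definition.
  exact congrArg (WithLp.toLp 2) (dgMatrix_mulVec_vec A (unvec z)).symm

theorem covariance_fderiv_g (hΓ : Γ.PosDef) (hS : S.PosDef) (B : Matrix (Fin D) (Fin L) ℝ)
    (p q : Fin D × Fin L) :
    cov[fun z => (fderiv ℝ (g Γ S) B (unvec z)).vec p,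
        fun z => (fderiv ℝ (g Γ S) B (unvec z)).vec q;
        multivariateGaussian 0 (Γ⁻¹ ⊗ₖ S)] = Theta Γ S B p q := by
  rw [← dgMatrix_mul_mul_transpose hΓ hS, ← covariance_mulVec_multivariateGaussian
    (hΓ.inv.kronecker hS).posSemidef]
  simp_rw [fderiv_g hΓ hS, ← dgMatrix_mulVec_vec]
  rfl

theorem ae_tendsto_Theta_Ahat (hΓ : Γ.PosDef) (hS : S.PosDef)
    (hm : IsForwardModel μ X Y (gammaStar Γ S A) (g Γ S A) (sigmaStar Γ S A)) :
    ∀ᵐ ω ∂μ, Tendsto (fun N => Theta Γ S (Ahat X Y N ω)) atTop (𝓝 (Theta Γ S A)) := by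
  filter_upwards [ae_tendsto_Ahat hΓ hS hm] with ω hω
  exact ((continuous_Theta hΓ hS).tendsto A).comp hω

theorem tendstoInMeasure_Theta_Ahat (hΓ : Γ.PosDef) (hS : S.PosDef)
    (hm : IsForwardModel μ X Y (gammaStar Γ S A) (g Γ S A) (sigmaStar Γ S A))
    (p q : Fin D × Fin L) :
    TendstoInMeasure μ (fun (N : ℕ) ω => Theta Γ S (Ahat X Y N ω) p q) atTop
      (fun _ => Theta Γ S A p q) := by
  refine tendstoInMeasure_of_tendsto_ae
    (fun N => (aemeasurable_Theta_Ahat hΓ hS hm N p q).aestronglyMeasurable) ?_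
  filter_upwards [ae_tendsto_Theta_Ahat hΓ hS hm] with ω hω
  exact tendsto_pi_nhds.1 (tendsto_pi_nhds.1 hω p) q

theorem tendstoInDistribution_quadStat (hΓ : Γ.PosDef) (hS : S.PosDef)
    (hm : IsForwardModel μ X Y (gammaStar Γ S A) (g Γ S A) (sigmaStar Γ S A))
    (hΘ : IsUnit (Theta Γ S A)) :
    TendstoInDistribution (quadStat Γ S A X Y) atTop id (fun _ => μ) (chiSquare (D * L)) := by
  have hdet : (Theta Γ S A).det ≠ 0 := ((Matrix.isUnit_iff_isUnit_det _).1 hΘ).ne_zero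
  -- A covariance matrix is positive semidefinite, so invertibility is all that positive
  -- definiteness requires.
  have hpos : (Theta Γ S A).PosDef := (posSemidef_Theta hΓ hS A).posDef_iff_isUnit.2 hΘ
  have hinv : ∀ᵐ ω ∂μ, Tendsto (fun N => (Theta Γ S (Ahat X Y N ω))⁻¹) atTop
      (𝓝 (Theta Γ S A)⁻¹) := by
    filter_upwards [ae_tendsto_Theta_Ahat hΓ hS hm] with ω hω
    exact tendsto_matrix_inv hdet hω
  have hinvm (N : ℕ) := aemeasurable_matrix_inv (aemeasurable_Theta_Ahat hΓ hS hm N)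
  have hf : Continuous fun p : EuclideanSpace ℝ (Fin D × Fin L)
      × (Fin D × Fin L → Fin D × Fin L → ℝ) => p.1.ofLp ⬝ᵥ (Matrix.of p.2 *ᵥ p.1.ofLp) := by
    have h : Continuous fun p : EuclideanSpace ℝ (Fin D × Fin L)
        × (Fin D × Fin L → Fin D × Fin L → ℝ) => p.1.ofLp := by fun_prop
    exact h.dotProduct (Continuous.matrix_mulVec continuous_snd h)
  have h1 := TendstoInDistribution.continuous_comp_prodMk_of_tendstoInMeasure_const hf
    (tendstoInDistribution_g_Ahat hΓ hS hm) (tendstoInMeasure_entries hinvm hinv)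
    (fun N => aemeasurable_pi_lambda _ fun i => aemeasurable_pi_lambda _ fun j => hinvm N i j)
  have h2 : quadStat Γ S A X Y = fun (N : ℕ) ω =>
      (√(N : ℝ) • (evec (g Γ S (Ahat X Y N ω)) - evec (g Γ S A))).ofLp ⬝ᵥ
        (Matrix.of (fun i j => (Theta Γ S (Ahat X Y N ω))⁻¹ i j) *ᵥ
          (√(N : ℝ) • (evec (g Γ S (Ahat X Y N ω)) - evec (g Γ S A))).ofLp) := by
    ext1 N
    ext1 ω
    rw [WithLp.ofLp_smul, Matrix.mulVec_smul, dotProduct_smul, smul_dotProduct, smul_smul,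
      Real.mul_self_sqrt N.cast_nonneg]
    rfl
  rw [h2]
  exact tendstoInDistribution_id_of_map_eq h1
    (map_quadratic_multivariateGaussian hpos finProdFinEquiv.symm)

end Limits

end InverseRegression

end

theorem mainTheorem1 {L D : ℕ} {Ω : Type*} [MeasurableSpace Ω] (μ : Measure Ω)
    [IsProbabilityMeasure μ]
    (Γ : Matrix (Fin L) (Fin L) ℝ) (S : Matrix (Fin D) (Fin D) ℝ) (A : Matrix (Fin D) (Fin L) ℝ)
    (hΓ : Γ.PosDef) (hS : S.PosDef) (hSdiag : S.IsDiag)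
    (X : ℕ → Ω → EuclideanSpace ℝ (Fin D)) (Y : ℕ → Ω → EuclideanSpace ℝ (Fin L))
    (hmodel : InverseRegression.IsForwardModel μ X Y (InverseRegression.gammaStar Γ S A)
      (InverseRegression.g Γ S A) (InverseRegression.sigmaStar Γ S A)) :
    -- `g` is differentiable, with the stated differential
    (∀ B : Matrix (Fin D) (Fin L) ℝ, DifferentiableAt ℝ (InverseRegression.g Γ S) B ∧
      ∀ H : Matrix (Fin D) (Fin L) ℝ,
        fderiv ℝ (InverseRegression.g Γ S) B H = InverseRegression.dgFormula Γ S B H) ∧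
    -- the limit law of `√N (Â - A)` is the centered matrix normal law with variances `Σ`, `Γ⁻¹`
    TendstoInDistribution
      (fun (N : ℕ) ω => √(N : ℝ) • (InverseRegression.evec (InverseRegression.Ahat X Y N ω)
        - InverseRegression.evec A))
      atTop id (fun _ => μ) (multivariateGaussian 0 (Γ⁻¹ ⊗ₖ S)) ∧
    -- `Θ(B)` is the covariance matrix of `vec (Dg(B) . Z)` for `Z` with that law
    (∀ (B : Matrix (Fin D) (Fin L) ℝ) (p q : Fin D × Fin L),
      cov[fun z => (fderiv ℝ (InverseRegression.g Γ S) B (InverseRegression.unvec z)).vec p,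
          fun z => (fderiv ℝ (InverseRegression.g Γ S) B (InverseRegression.unvec z)).vec q;
          multivariateGaussian 0 (Γ⁻¹ ⊗ₖ S)] = InverseRegression.Theta Γ S B p q) ∧
    -- asymptotic normality
    TendstoInDistribution
      (fun (N : ℕ) ω => √(N : ℝ) •
        (InverseRegression.evec (InverseRegression.g Γ S (InverseRegression.Ahat X Y N ω))
          - InverseRegression.evec (InverseRegression.g Γ S A)))
      atTop id (fun _ => μ) (multivariateGaussian 0 (InverseRegression.Theta Γ S A)) ∧
    -- consistency of the plug-in covariance
    (∀ p q : Fin D × Fin L, TendstoInMeasure μ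
      (fun (N : ℕ) ω => InverseRegression.Theta Γ S (InverseRegression.Ahat X Y N ω) p q)
      atTop (fun _ => InverseRegression.Theta Γ S A p q)) ∧
    -- the chi-square limit
    (IsUnit (InverseRegression.Theta Γ S A) →
      TendstoInDistribution (InverseRegression.quadStat Γ S A X Y)
        atTop id (fun _ => μ) (InverseRegression.chiSquare (D * L))) := by
  open InverseRegression in
  exact ⟨fun B => ⟨(hasFDerivAt_g hΓ hS B).differentiableAt, fderiv_g hΓ hS B⟩,
    tendstoInDistribution_Ahat hΓ hS hmodel, covariance_fderiv_g hΓ hS,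
    tendstoInDistribution_g_Ahat hΓ hS hmodel, tendstoInMeasure_Theta_Ahat hΓ hS hmodel,
    tendstoInDistribution_quadStat hΓ hS hmodel⟩
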